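/- Let $M\ge 2$ and $N\ge 1$ be integers. Let $\mathbb{C}^{M\times M}_{\mathrm{sym}}$ and $\mathbb{C}^{M\times M}_{\mathrm{skew}}$ denote the spaces of symmetric and skew-symmetric complex $M\times M$ matrices, and let $$\mathcal{B}_{M,N}\subset \mathbb{P}\bigl(\mathbb{C}^{M\times N}\times\mathbb{C}^{M\times N}\bigr)\times\mathbb{P}\bigl(\mathbb{C}^{M\times M}_{\mathrm{sym}}\times\mathbb{C}^{M\times M}_{\mathrm{skew}}\bigr)$$ be the set of all points $([U,V],[X,Y])$ such that $$\operatorname{rank}(X+iY)\le 2\quad\text{and}\quad u_n^TXu_n+v_n^TXv_n-2u_n^TYv_n=0\ \text{ for all } 1\le n\le N,$$ where $u_n$ and $v_n$ are the $n$th columns of $U$ and $V$. Then $\mathcal{B}_{M,N}$ is closed in the Zariski topology of the product (whose closed sets are the common zero sets of bihomogeneous polynomials), and its dimension, that is, the supremum of the lengths of chains of irreducible closed subsets of $\mathcal{B}_{M,N}$, is exactly $$\dim \mathcal{B}_{M,N}=2MN-N+4M-6.$$ -/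

import Mathlib

open Matrix
open scoped LinearAlgebra.Projectivization

noncomputable section

namespace PhaseRetrieval

/-- The product `ℙ(V) × ℙ(W)` of two complex projective spaces. It is a type of its own so that it
carries the Zariski topology of the product variety (defined below), which is finer than the
product of the two Zariski topologies. -/
def BiProj (V W : Type*) [AddCommGroup V] [Module ℂ V] [AddCommGroup W] [Module ℂ W] : Type _ :=
  ℙ ℂ V × ℙ ℂ W

section Zariski

variable (V W : Type*) [AddCommGroup V] [Module ℂ V] [AddCommGroup W] [Module ℂ W]

/-- Polynomials on `V × W`, written without choosing bases: the indeterminates are the linear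
coordinate functions on `V` (left summand) and those on `W` (right summand). -/
abbrev CoordPoly : Type _ := MvPolynomial (Module.Dual ℂ V ⊕ Module.Dual ℂ W) ℂ

variable {V W}

/-- The value of a polynomial at a pair of vectors `(v, w)`. -/
def evalAt (v : V) (w : W) (f : CoordPoly V W) : ℂ :=
  MvPolynomial.eval (Sum.elim (fun l => l v) (fun l => l w)) f

/-- `f` is homogeneous of some degree `d` in the coordinates of `V` and, separately, of some
degree `e` in the coordinates of `W`. -/
def IsBihomogeneous (f : CoordPoly V W) : Prop :=
  ∃ d e : ℕ, MvPolynomial.IsWeightedHomogeneous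
    (Sum.elim (fun _ => ((1, 0) : ℕ × ℕ)) (fun _ => ((0, 1) : ℕ × ℕ))) f (d, e)

/-- The common zero set in `ℙ(V) × ℙ(W)` of a set of polynomials. For bihomogeneous polynomials
the choice of the representatives does not matter, see `mk_mem_zeroLocus`. -/
def zeroLocus (S : Set (CoordPoly V W)) : Set (BiProj V W) :=
  {p | ∀ f ∈ S, evalAt p.1.rep p.2.rep f = 0}

theorem IsBihomogeneous.mul {f g : CoordPoly V W} (hf : IsBihomogeneous f)
    (hg : IsBihomogeneous g) : IsBihomogeneous (f * g) := by
  obtain ⟨d, e, hf⟩ := hf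
  obtain ⟨d', e', hg⟩ := hg
  exact ⟨d + d', e + e', MvPolynomial.IsWeightedHomogeneous.mul hf hg⟩

theorem IsBihomogeneous.evalAt_smul {f : CoordPoly V W} (hf : IsBihomogeneous f) :
    ∃ d e : ℕ, ∀ (a b : ℂ) (v : V) (w : W),
      evalAt (a • v) (b • w) f = a ^ d * b ^ e * evalAt v w f := by
  obtain ⟨d, e, hf⟩ := hf
  refine ⟨d, e, fun a b v w => ?_⟩
  unfold evalAt
  rw [MvPolynomial.eval_eq, MvPolynomial.eval_eq, Finset.mul_sum]
  refine Finset.sum_congr rfl fun m hm => ?_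
  have hw := hf (MvPolynomial.mem_support_iff.mp hm)
  have key : ∀ i, (Sum.elim (fun l : Module.Dual ℂ V => l (a • v))
      (fun l : Module.Dual ℂ W => l (b • w)) i) ^ m i
      = (a ^ (m i • (Sum.elim (fun _ => ((1, 0) : ℕ × ℕ)) (fun _ => ((0, 1) : ℕ × ℕ)) i :
          ℕ × ℕ)).1 *
        b ^ (m i • (Sum.elim (fun _ => ((1, 0) : ℕ × ℕ)) (fun _ => ((0, 1) : ℕ × ℕ)) i :
          ℕ × ℕ)).2) *
        (Sum.elim (fun l : Module.Dual ℂ V => l v) (fun l : Module.Dual ℂ W => l w) i) ^ m i := by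
    rintro (l | l) <;> simp [mul_pow]
  rw [Finsupp.weight_apply, Finsupp.sum] at hw
  have h1 := congrArg Prod.fst hw
  have h2 := congrArg Prod.snd hw
  rw [Prod.fst_sum] at h1
  rw [Prod.snd_sum] at h2
  rw [Finset.prod_congr rfl fun i _ => key i, Finset.prod_mul_distrib, Finset.prod_mul_distrib,
    Finset.prod_pow_eq_pow_sum, Finset.prod_pow_eq_pow_sum, h1, h2]
  ring

/-- Vanishing of bihomogeneous polynomials may be tested on any representatives. -/
theorem mk_mem_zeroLocus {S : Set (CoordPoly V W)} (hS : ∀ f ∈ S, IsBihomogeneous f)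
    {v : V} (hv : v ≠ 0) {w : W} (hw : w ≠ 0) :
    ((Projectivization.mk ℂ v hv, Projectivization.mk ℂ w hw) : BiProj V W) ∈ zeroLocus S ↔
      ∀ f ∈ S, evalAt v w f = 0 := by
  obtain ⟨a, ha⟩ := Projectivization.exists_smul_eq_mk_rep ℂ v hv
  obtain ⟨b, hb⟩ := Projectivization.exists_smul_eq_mk_rep ℂ w hw
  refine forall₂_congr fun f hf => ?_
  obtain ⟨d, e, h⟩ := (hS f hf).evalAt_smul
  change evalAt (Projectivization.mk ℂ v hv).rep (Projectivization.mk ℂ w hw).rep f = 0 ↔ _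
  rw [← ha, ← hb, Units.smul_def, Units.smul_def, h]
  simp

/-- The Zariski topology on `ℙ(V) × ℙ(W)`: the closed sets are the common zero sets of sets of
bihomogeneous polynomials. -/
instance BiProj.zariskiTopology : TopologicalSpace (BiProj V W) :=
  TopologicalSpace.ofClosed
    {Z | ∃ S : Set (CoordPoly V W), (∀ f ∈ S, IsBihomogeneous f) ∧ Z = zeroLocus S}
    (by
      refine ⟨{1}, ?_, ?_⟩
      · rintro f rfl
        exact ⟨0, 0, MvPolynomial.isWeightedHomogeneous_one ℂ _⟩
      · ext p
        simp [zeroLocus, evalAt])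
    (by
      intro A hA
      refine ⟨{f | IsBihomogeneous f ∧ ∃ Z ∈ A, ∀ p ∈ Z, evalAt p.1.rep p.2.rep f = 0},
        fun f hf => hf.1, ?_⟩
      ext p
      constructor
      · rintro hp f ⟨-, Z, hZ, h⟩
        exact h p (hp Z hZ)
      · intro hp Z hZ
        obtain ⟨S, hS, hZS⟩ := hA hZ
        rw [hZS]
        intro f hf
        refine hp f ⟨hS f hf, Z, hZ, fun q hq => ?_⟩
        rw [hZS] at hq
        exact hq f hf)
    (by
      rintro _ ⟨S, hS, rfl⟩ _ ⟨T, hT, rfl⟩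
      refine ⟨{h | ∃ f ∈ S, ∃ g ∈ T, h = f * g}, ?_, ?_⟩
      · rintro _ ⟨f, hf, g, hg, rfl⟩
        exact (hS f hf).mul (hT g hg)
      · ext p
        constructor
        · rintro (hp | hp) _ ⟨f, hf, g, hg, rfl⟩
          · have := hp f hf
            simp_all [evalAt]
          · have := hp g hg
            simp_all [evalAt]
        · intro hp
          by_contra hn
          simp only [Set.mem_union, not_or, zeroLocus, Set.mem_ofPred_eq, not_forall] at hn
          obtain ⟨⟨f, hf, hf0⟩, g, hg, hg0⟩ := hn
          have := hp _ ⟨f, hf, g, hg, rfl⟩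
          simp only [evalAt, map_mul, mul_eq_zero] at this
          exact this.elim hf0 hg0)

theorem isClosed_iff {Z : Set (BiProj V W)} :
    IsClosed Z ↔
      ∃ S : Set (CoordPoly V W), (∀ f ∈ S, IsBihomogeneous f) ∧ Z = zeroLocus S := by
  rw [← isOpen_compl_iff]
  change Zᶜᶜ ∈ _ ↔ _
  rw [compl_compl]
  rfl

end Zariski

/-- The space of symmetric complex `M × M` matrices. -/
def symMatrices (M : ℕ) : Submodule ℂ (Matrix (Fin M) (Fin M) ℂ) where
  carrier := {X | Xᵀ = X}
  add_mem' := by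
    intro A B hA hB
    simp_all [Matrix.transpose_add]
  zero_mem' := by simp
  smul_mem' := by
    intro c A hA
    simp_all [Matrix.transpose_smul]

/-- The space of skew-symmetric complex `M × M` matrices. -/
def skewMatrices (M : ℕ) : Submodule ℂ (Matrix (Fin M) (Fin M) ℂ) where
  carrier := {Y | Yᵀ = -Y}
  add_mem' := by
    intro A B hA hB
    simp_all [Matrix.transpose_add, add_comm]
  zero_mem' := by simp
  smul_mem' := by
    intro c A hA
    simp_all [Matrix.transpose_smul]

/-- The pairs `(U, V)` of complex `M × N` matrices. -/
abbrev FramePair (M N : ℕ) : Type :=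
  Matrix (Fin M) (Fin N) ℂ × Matrix (Fin M) (Fin N) ℂ

/-- The pairs `(X, Y)` with `X` symmetric and `Y` skew-symmetric. -/
abbrev SymSkewPair (M : ℕ) : Type := symMatrices M × skewMatrices M

/-- The condition that defines the variety: `rank (X + iY) ≤ 2` and, for the `n`-th columns
`uₙ`, `vₙ` of `U`, `V`, `uₙᵀ X uₙ + vₙᵀ X vₙ - 2 uₙᵀ Y vₙ = 0` for every `n`. -/
def Incident {M N : ℕ} (U V : Matrix (Fin M) (Fin N) ℂ) (X Y : Matrix (Fin M) (Fin M) ℂ) : Prop :=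
  (X + Complex.I • Y).rank ≤ 2 ∧
    ∀ n : Fin N, U.col n ⬝ᵥ (X *ᵥ U.col n) + V.col n ⬝ᵥ (X *ᵥ V.col n)
      - 2 * (U.col n ⬝ᵥ (Y *ᵥ V.col n)) = 0

/-- The set of all `([U, V], [X, Y])` that satisfy the condition. It does not depend on the
representatives, see `mk_mem_varietyB`. -/
def varietyB (M N : ℕ) : Set (BiProj (FramePair M N) (SymSkewPair M)) :=
  {p | Incident p.1.rep.1 p.1.rep.2 p.2.rep.1 p.2.rep.2}

theorem incident_smul {M N : ℕ} {a b : ℂ} (ha : a ≠ 0) (hb : b ≠ 0)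
    (U V : Matrix (Fin M) (Fin N) ℂ) (X Y : Matrix (Fin M) (Fin M) ℂ) :
    Incident (a • U) (a • V) (b • X) (b • Y) ↔ Incident U V X Y := by
  have hr : (b • X + Complex.I • b • Y).rank = (X + Complex.I • Y).rank := by
    rw [smul_comm Complex.I b Y, ← smul_add]
    exact Matrix.rank_smul_of_mem_nonZeroDivisors _ (mem_nonZeroDivisors_of_ne_zero hb)
  have hU : ∀ (A : Matrix (Fin M) (Fin N) ℂ) n, (a • A).col n = a • A.col n := fun A n => rfl
  unfold Incident
  rw [hr]
  refine and_congr_right fun _ => forall_congr' fun n => ?_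
  simp only [hU, Matrix.smul_mulVec, Matrix.mulVec_smul, smul_dotProduct, dotProduct_smul,
    smul_eq_mul]
  constructor
  · intro h
    have hc : a * a * b ≠ 0 := mul_ne_zero (mul_ne_zero ha ha) hb
    refine (mul_eq_zero.mp (?_ : a * a * b * _ = 0)).resolve_left hc
    rw [← h]
    ring
  · intro h
    linear_combination a * a * b * h

theorem mk_mem_varietyB {M N : ℕ} {q : FramePair M N} (hq : q ≠ 0) {r : SymSkewPair M}
    (hr : r ≠ 0) :
    ((Projectivization.mk ℂ q hq, Projectivization.mk ℂ r hr) :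
      BiProj (FramePair M N) (SymSkewPair M)) ∈ varietyB M N ↔ Incident q.1 q.2 r.1 r.2 := by
  obtain ⟨a, ha⟩ := Projectivization.exists_smul_eq_mk_rep ℂ q hq
  obtain ⟨b, hb⟩ := Projectivization.exists_smul_eq_mk_rep ℂ r hr
  rw [← incident_smul a.ne_zero b.ne_zero]
  change Incident (Projectivization.mk ℂ q hq).rep.1 (Projectivization.mk ℂ q hq).rep.2
    (Projectivization.mk ℂ r hr).rep.1 (Projectivization.mk ℂ r hr).rep.2 ↔ _
  rw [← ha, ← hb]
  rfl

end PhaseRetrieval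

end

/-!
The linear coordinates `z = u + iv`, `w = u - iv`, `Q = X + iY` turn the incidence condition into
`rank Q ≤ 2` and `wₙᵀ Q zₙ = 0` for all `n`, where `Q` is now an arbitrary `M × M` matrix
(`incident_iff`). Closedness follows, since `rank Q ≤ 2` is the vanishing of the minors of size `3`.

*Upper bound.* To an irreducible closed subset `Z` belongs the ideal of all polynomials that vanish
on the bi-cone over `Z`. It is prime (`isPrime_vanishingIdeal`), and it determines `Z`, so the
transcendence degree of its quotient ring grows strictly with `Z` (`trdeg_lt_of_surjective`). This
degree is at least `2`, because of the two scalings (`two_le_trdeg`), and at most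
`2MN - N + 4M - 4` (`trdeg_le_of_incident`): over the function field the nonzero matrix `Q` is
generated by two of its columns and by the `2(M - 2)` coefficients with which they span the others,
and each equation `wₙᵀ Q zₙ = 0` makes one of the `2M` coordinates of `(zₙ, wₙ)` a rational function
of the other ones. A chain of irreducible closed subsets therefore has length at most
`2MN - N + 4M - 6`.

*Lower bound.* The matrices `Q = c aᵀ + c' bᵀ` with `c = (1, *)`, `a = (1, *)`, `c' = (0, *)` and
`b = (0, 1, *)`, arbitrary `zₙ` with the first entry of `z₀` equal to `1`, and
`wₙ = (-∑ sᵢ (Q zₙ)ᵢ, (Q zₙ)₀ s)` form a polynomial family of points of the variety with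
`2MN - N + 4M - 6` parameters. A polynomial family has irreducible closure
(`isIrreducible_range_mk`), so switching the parameters on one by one gives a chain of irreducible
closed subsets. It is strict, because each parameter is detected by a bihomogeneous polynomial, an
entry of `z`, `w` or `Q` or a minor of size `2` of `Q` (`card_le_topologicalKrullDim`).
-/

noncomputable section

namespace PhaseRetrieval

/-! ### Rank and minors -/

section Rank

variable {K m n : Type*} [Field K] [Fintype m] [Fintype n]

theorem exists_linearIndependent_cols {A : Matrix m n K} {k : ℕ} (h : k ≤ A.rank) :
    ∃ c : Fin k → n, LinearIndependent K fun j => A.col (c j) := by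
  rw [Matrix.rank_eq_finrank_span_cols] at h
  obtain ⟨f, hf, -, hli⟩ := Submodule.exists_fun_fin_finrank_span_eq K (Set.range A.col)
  choose c hc using hf
  refine ⟨fun j => c (Fin.castLE h j), ?_⟩
  simp only [hc]
  exact hli.comp _ (Fin.castLE_injective h)

/-- Over a field, the rank is at most `k` if and only if all minors of size `k + 1` vanish. -/
theorem rank_le_iff_minors_eq_zero {A : Matrix m n K} {k : ℕ} :
    A.rank ≤ k ↔ ∀ (r : Fin (k + 1) → m) (c : Fin (k + 1) → n), (A.submatrix r c).det = 0 := by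
  constructor
  · intro h r c
    by_contra hd
    have h1 := Matrix.rank_of_det_ne_zero hd
    have h2 := Matrix.rank_submatrix_le A r c
    simp at h1
    omega
  · intro h
    by_contra! hk
    obtain ⟨c, hc⟩ := exists_linearIndependent_cols (k := k + 1) hk
    have h1 : (A.submatrix id c)ᵀ.rank = k + 1 := by
      simpa using LinearIndependent.rank_matrix (M := (A.submatrix id c)ᵀ) hc
    -- the `k + 1` independent columns form a matrix that also has `k + 1` independent rows
    obtain ⟨r, hr⟩ := exists_linearIndependent_cols (A := (A.submatrix id c)ᵀ) h1.ge
    refine (Matrix.isUnit_iff_isUnit_det _).mp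
      (Matrix.linearIndependent_rows_iff_isUnit (A := A.submatrix r c).mp hr) |>.ne_zero (h r c)

/-- A matrix of rank at most `2` has two columns that span all the others. -/
theorem exists_two_spanning_cols [DecidableEq n] {A : Matrix m n K} (h : A.rank ≤ 2)
    (hn : 2 ≤ Fintype.card n) :
    ∃ j₁ j₂ : n, j₁ ≠ j₂ ∧ ∃ a b : n → K, ∀ i j, A i j = a j * A i j₁ + b j * A i j₂ := by
  rw [Matrix.rank_eq_finrank_span_cols] at h
  obtain ⟨f, hf, hspan, -⟩ := Submodule.exists_fun_fin_finrank_span_eq K (Set.range A.col)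
  choose c hc using hf
  -- the basis may have fewer than two columns; it is enlarged to exactly two
  obtain ⟨J, hJ, hJc⟩ : ∃ J : Finset n, Finset.univ.image c ⊆ J ∧ J.card = 2 :=
    Finset.exists_superset_card_eq (Finset.card_image_le.trans (by simpa using h)) hn
  obtain ⟨j₁, j₂, hne, rfl⟩ := Finset.card_eq_two.mp hJc
  refine ⟨j₁, j₂, hne, ?_⟩
  have key : ∀ j, ∃ a b : K, a • A.col j₁ + b • A.col j₂ = A.col j := by
    intro j
    rw [← Submodule.mem_span_pair]
    have h1 : A.col j ∈ Submodule.span K (Set.range f) := by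
      rw [hspan]
      exact Submodule.subset_span ⟨j, rfl⟩
    refine Submodule.span_mono ?_ h1
    rintro _ ⟨i, rfl⟩
    have := hJ (Finset.mem_image_of_mem c (Finset.mem_univ i))
    rw [← hc]
    simp only [Finset.mem_insert, Finset.mem_singleton] at this
    rcases this with h | h <;> simp [h]
  choose a b hab using key
  exact ⟨a, b, fun i j => (congrFun (hab j) i).symm⟩

end Rank

/-! ### Linear coordinates -/

section Coordinates

variable (M N : ℕ)

/-- The linear coordinates `z = u + iv` and `w = u - iv` on the pairs `(U, V)`: at the index
`(n, inl i)` stands the `i`-th entry of `z_n`, at `(n, inr i)` the `i`-th entry of `w_n`. -/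
def frameEquiv : FramePair M N ≃ₗ[ℂ] (Fin N × (Fin M ⊕ Fin M) → ℂ) where
  toFun p q := Sum.elim (fun i => p.1 i q.1 + Complex.I * p.2 i q.1)
    (fun i => p.1 i q.1 - Complex.I * p.2 i q.1) q.2
  invFun f := (Matrix.of fun i n => (f (n, .inl i) + f (n, .inr i)) / 2,
    Matrix.of fun i n => (f (n, .inl i) - f (n, .inr i)) / (2 * Complex.I))
  map_add' p q := by
    ext ⟨n, i | i⟩ <;> simp <;> ring
  map_smul' c p := by
    ext ⟨n, i | i⟩ <;> simp <;> ring
  left_inv p := by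
    have := Complex.I_ne_zero
    ext i n <;> simp
    field_simp
    ring
  right_inv f := by
    have := Complex.I_ne_zero
    ext ⟨n, i | i⟩ <;> simp <;> field_simp <;> ring

/-- The linear coordinates on the pairs `(X, Y)`: the entries of the matrix `X + iY`. -/
def pairEquiv : SymSkewPair M ≃ₗ[ℂ] (Fin M × Fin M → ℂ) where
  toFun p q := p.1.1 q.1 q.2 + Complex.I * p.2.1 q.1 q.2
  invFun f := (⟨Matrix.of fun i j => (f (i, j) + f (j, i)) / 2, by
      ext i j; simp [add_comm]⟩,
    ⟨Matrix.of fun i j => (f (i, j) - f (j, i)) / (2 * Complex.I), by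
      ext i j; simp; ring⟩)
  map_add' p q := by
    ext ⟨i, j⟩; simp; ring
  map_smul' c p := by
    ext ⟨i, j⟩; simp; ring
  left_inv p := by
    obtain ⟨⟨X, hX⟩, ⟨Y, hY⟩⟩ := p
    have hX' : ∀ i j, X j i = X i j := fun i j => congrFun (congrFun hX i) j
    have hY' : ∀ i j, Y j i = - Y i j := fun i j => congrFun (congrFun hY i) j
    have := Complex.I_ne_zero
    ext i j
    · simp [hX' i j, hY' i j]
      ring
    · simp [hX' i j, hY' i j]; field_simp; ring
  right_inv f := by
    have := Complex.I_ne_zero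
    ext ⟨i, j⟩; simp; field_simp; ring

/-- The basis of the pairs `(U, V)` whose coordinates are the entries of the `zₙ` and `wₙ`. -/
def frameBasis : Module.Basis (Fin N × (Fin M ⊕ Fin M)) ℂ (FramePair M N) :=
  Module.Basis.ofEquivFun (frameEquiv M N)

/-- The basis of the pairs `(X, Y)` whose coordinates are the entries of `X + iY`. -/
def pairBasis : Module.Basis (Fin M × Fin M) ℂ (SymSkewPair M) :=
  Module.Basis.ofEquivFun (pairEquiv M)

variable {M N}

/-- In the coordinates `z = u + iv`, `w = u - iv`, `Q = X + iY` the incidence condition reads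
`rank Q ≤ 2` and `wₙᵀ Q zₙ = 0` for all `n`. -/
theorem incident_iff (p : FramePair M N) (q : SymSkewPair M) :
    Incident p.1 p.2 q.1 q.2 ↔
      (Matrix.of fun i j => (pairBasis M).coord (i, j) q).rank ≤ 2 ∧
      ∀ n, ∑ i, ∑ j, (frameBasis M N).coord (n, .inr i) p * (pairBasis M).coord (i, j) q *
        (frameBasis M N).coord (n, .inl j) p = 0 := by
  obtain ⟨U, V⟩ := p
  obtain ⟨⟨X, hX⟩, ⟨Y, hY⟩⟩ := q
  have hX' : Xᵀ = X := hX
  have hY' : Yᵀ = -Y := hY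
  have h1 : (Matrix.of fun i j => (pairBasis M).coord (i, j) (⟨X, hX⟩, ⟨Y, hY⟩)) =
      X + Complex.I • Y := by
    ext i j
    simp [pairBasis, pairEquiv]
  have h2 : ∀ n, ∑ i, ∑ j, (frameBasis M N).coord (n, .inr i) (U, V) *
      (pairBasis M).coord (i, j) (⟨X, hX⟩, ⟨Y, hY⟩) * (frameBasis M N).coord (n, .inl j) (U, V) =
      (U.col n - Complex.I • V.col n) ⬝ᵥ
        ((X + Complex.I • Y) *ᵥ (U.col n + Complex.I • V.col n)) := by
    intro n
    simp only [dotProduct, mulVec, Finset.mul_sum]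
    refine Finset.sum_congr rfl fun i _ => Finset.sum_congr rfl fun j _ => ?_
    simp [pairBasis, pairEquiv, frameBasis, frameEquiv]
    ring
  have hsym : ∀ u v, v ⬝ᵥ X *ᵥ u = u ⬝ᵥ X *ᵥ v := by
    intro u v
    rw [dotProduct_comm, ← vecMul_transpose, hX', dotProduct_mulVec]
  have hskew : ∀ u v, v ⬝ᵥ Y *ᵥ u = - (u ⬝ᵥ Y *ᵥ v) := by
    intro u v
    rw [dotProduct_comm, ← vecMul_transpose, hY', dotProduct_mulVec, vecMul_neg, neg_dotProduct]
  have hzero : ∀ u, u ⬝ᵥ Y *ᵥ u = 0 := fun u => self_eq_neg.mp (hskew u u)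
  have hI : Complex.I * Complex.I = -1 := Complex.I_mul_I
  unfold Incident
  rw [h1]
  refine and_congr_right fun _ => forall_congr' fun n => ?_
  rw [h2]
  simp only [add_mulVec, smul_mulVec, mulVec_add, mulVec_smul, sub_dotProduct, dotProduct_add,
    smul_dotProduct, dotProduct_smul, smul_eq_mul, hzero, hsym (V.col n) (U.col n),
    hskew (V.col n) (U.col n)]
  constructor <;> intro h
  · linear_combination h - (V.col n ⬝ᵥ X *ᵥ V.col n + 2 * (V.col n ⬝ᵥ Y *ᵥ U.col n)) * hI
  · linear_combination h + (V.col n ⬝ᵥ X *ᵥ V.col n + 2 * (V.col n ⬝ᵥ Y *ᵥ U.col n)) * hI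

end Coordinates

/-! ### Vanishing ideals of bi-cones -/

section VanishingIdeal

variable {V W : Type*} [AddCommGroup V] [Module ℂ V] [AddCommGroup W] [Module ℂ W]

/-- The weights of the indeterminates that define the bidegree. -/
abbrev bidegree (V W : Type*) [AddCommGroup V] [Module ℂ V] [AddCommGroup W] [Module ℂ W] :
    Module.Dual ℂ V ⊕ Module.Dual ℂ W → ℕ × ℕ :=
  Sum.elim (fun _ => (1, 0)) (fun _ => (0, 1))

theorem evalAt_smul_of_bidegree {f : CoordPoly V W} {d : ℕ × ℕ}
    (hf : MvPolynomial.IsWeightedHomogeneous (bidegree V W) f d) (a b : ℂ) (v : V) (w : W) :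
    evalAt (a • v) (b • w) f = a ^ d.1 * b ^ d.2 * evalAt v w f := by
  unfold evalAt
  rw [MvPolynomial.eval_eq, MvPolynomial.eval_eq, Finset.mul_sum]
  refine Finset.sum_congr rfl fun m hm => ?_
  have hw := hf (MvPolynomial.mem_support_iff.mp hm)
  have key : ∀ i, (Sum.elim (fun l : Module.Dual ℂ V => l (a • v))
      (fun l : Module.Dual ℂ W => l (b • w)) i) ^ m i
      = (a ^ (m i • bidegree V W i).1 * b ^ (m i • bidegree V W i).2) *
        (Sum.elim (fun l : Module.Dual ℂ V => l v) (fun l : Module.Dual ℂ W => l w) i) ^ m i := by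
    rintro (l | l) <;> simp [mul_pow]
  rw [Finsupp.weight_apply, Finsupp.sum] at hw
  rw [← hw, Prod.fst_sum, Prod.snd_sum, Finset.prod_congr rfl fun i _ => key i,
    Finset.prod_mul_distrib, Finset.prod_mul_distrib, Finset.prod_pow_eq_pow_sum,
    Finset.prod_pow_eq_pow_sum]
  ring

/-- Restricted to the pairs `(a • v, b • w)`, a polynomial becomes a polynomial in `a` and `b`; its
coefficients are the values at `(v, w)` of the bihomogeneous components. -/
theorem exists_polynomial_evalAt_smul (f : CoordPoly V W) (v : V) (w : W) :
    ∃ P : MvPolynomial (Fin 2) ℂ,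
      (∀ x : Fin 2 → ℂ, MvPolynomial.eval x P = evalAt (x 0 • v) (x 1 • w) f) ∧
      (P = 0 ↔ ∀ d, evalAt v w (MvPolynomial.weightedHomogeneousComponent (bidegree V W) d f)
        = 0) := by
  classical
  set c : ℕ × ℕ → CoordPoly V W := fun d =>
    MvPolynomial.weightedHomogeneousComponent (bidegree V W) d f with hc
  have hfin : (Function.support c).Finite :=
    MvPolynomial.weightedHomogeneousComponent_finsupp (w := bidegree V W) f
  have hsum : f = ∑ d ∈ hfin.toFinset, c d := by
    conv_lhs => rw [← MvPolynomial.sum_weightedHomogeneousComponent (w := bidegree V W) f]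
    exact finsum_eq_sum _ hfin
  -- the exponent vector of the monomial `a ^ d.1 * b ^ d.2`
  let e : ℕ × ℕ → (Fin 2 →₀ ℕ) := fun d => Finsupp.single 0 d.1 + Finsupp.single 1 d.2
  have he : ∀ d d', e d = e d' ↔ d = d' := by
    refine fun d d' => ⟨fun h => ?_, fun h => h ▸ rfl⟩
    have h0 := DFunLike.congr_fun h 0
    have h1 := DFunLike.congr_fun h 1
    simp [e] at h0 h1
    exact Prod.ext h0 h1
  refine ⟨∑ d ∈ hfin.toFinset, MvPolynomial.monomial (e d) (evalAt v w (c d)), fun x => ?_,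
    fun h d => ?_, fun h => Finset.sum_eq_zero fun d _ => by simp [hc, h d]⟩
  · have h1 : evalAt (x 0 • v) (x 1 • w) f = ∑ d ∈ hfin.toFinset,
        evalAt (x 0 • v) (x 1 • w) (c d) := by
      conv_lhs => rw [hsum]
      unfold evalAt
      rw [map_sum]
    rw [h1, map_sum]
    refine Finset.sum_congr rfl fun d _ => ?_
    rw [evalAt_smul_of_bidegree
      (MvPolynomial.weightedHomogeneousComponent_isWeightedHomogeneous d f),
      MvPolynomial.eval_monomial, Finsupp.prod_fintype _ _ (by simp)]
    simp [e, Fin.prod_univ_two]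
    ring
  · by_cases hd : d ∈ hfin.toFinset
    · have h2 := congrArg (MvPolynomial.coeff (e d)) h
      simpa [MvPolynomial.coeff_sum, MvPolynomial.coeff_monomial, he, hd] using h2
    · have : c d = 0 := by simpa using hd
      change evalAt v w (c d) = 0
      simp [this, evalAt]

/-- The point of `ℙ(V) × ℙ(W)` with the homogeneous coordinates `v` and `w`. -/
def BiProj.mk {v : V} {w : W} (hv : v ≠ 0) (hw : w ≠ 0) : BiProj V W :=
  (Projectivization.mk ℂ v hv, Projectivization.mk ℂ w hw)

theorem BiProj.mk_smul {v : V} {w : W} (hv : v ≠ 0) (hw : w ≠ 0) {a b : ℂ} (ha : a ≠ 0)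
    (hb : b ≠ 0) :
    BiProj.mk (smul_ne_zero ha hv) (smul_ne_zero hb hw) = BiProj.mk hv hw := by
  refine Prod.ext ?_ ?_
  · exact (Projectivization.mk_eq_mk_iff' ℂ _ _ _ _).mpr ⟨a, rfl⟩
  · exact (Projectivization.mk_eq_mk_iff' ℂ _ _ _ _).mpr ⟨b, rfl⟩

theorem BiProj.exists_mk (p : BiProj V W) :
    ∃ (v : V) (w : W) (hv : v ≠ 0) (hw : w ≠ 0), p = BiProj.mk hv hw :=
  ⟨p.1.rep, p.2.rep, p.1.rep_nonzero, p.2.rep_nonzero,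
    Prod.ext p.1.mk_rep.symm p.2.mk_rep.symm⟩

/-- The ideal of the polynomials, bihomogeneous or not, that vanish on the bi-cone over a subset
of `ℙ(V) × ℙ(W)`. -/
def vanishingIdeal (A : Set (BiProj V W)) : Ideal (CoordPoly V W) where
  carrier := {f | ∀ (v : V) (w : W) (hv : v ≠ 0) (hw : w ≠ 0), BiProj.mk hv hw ∈ A →
    evalAt v w f = 0}
  add_mem' hf hg v w hv hw h := by
    have h1 := hf v w hv hw h
    have h2 := hg v w hv hw h
    simp_all [evalAt]
  zero_mem' v w hv hw h := by simp [evalAt]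
  smul_mem' c f hf v w hv hw h := by
    have h1 := hf v w hv hw h
    simp_all [evalAt]

theorem mem_vanishingIdeal {A : Set (BiProj V W)} {f : CoordPoly V W} :
    f ∈ vanishingIdeal A ↔ ∀ (v : V) (w : W) (hv : v ≠ 0) (hw : w ≠ 0), BiProj.mk hv hw ∈ A →
      evalAt v w f = 0 := Iff.rfl

theorem vanishingIdeal_anti {A B : Set (BiProj V W)} (h : A ⊆ B) :
    vanishingIdeal B ≤ vanishingIdeal A :=
  fun _ hf v w hv hw hA => hf v w hv hw (h hA)

/-- A closed set is determined by its vanishing ideal. -/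
theorem subset_of_vanishingIdeal_le {A Z : Set (BiProj V W)} (hZ : IsClosed Z)
    (h : vanishingIdeal Z ≤ vanishingIdeal A) : A ⊆ Z := by
  obtain ⟨S, hS, rfl⟩ := isClosed_iff.mp hZ
  intro p hp
  obtain ⟨v, w, hv, hw, rfl⟩ := p.exists_mk
  refine (mk_mem_zeroLocus hS hv hw).mpr fun f hf => ?_
  exact h (fun v' w' hv' hw' h' => (mk_mem_zeroLocus hS hv' hw').mp h' f hf) v w hv hw hp

/-- The points whose bi-cone fibre lies in the zero set of `f` form a closed set. -/
theorem isClosed_setOf_evalAt_smul_eq_zero (f : CoordPoly V W) :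
    IsClosed {p : BiProj V W | ∀ a b : ℂ, evalAt (a • p.1.rep) (b • p.2.rep) f = 0} := by
  refine isClosed_iff.mpr
    ⟨Set.range fun d => MvPolynomial.weightedHomogeneousComponent (bidegree V W) d f, ?_, ?_⟩
  · rintro _ ⟨d, rfl⟩
    exact ⟨d.1, d.2, MvPolynomial.weightedHomogeneousComponent_isWeightedHomogeneous d f⟩
  · ext p
    obtain ⟨P, hP, hP0⟩ := exists_polynomial_evalAt_smul f p.1.rep p.2.rep
    have : p ∈ zeroLocus (Set.range fun d =>
        MvPolynomial.weightedHomogeneousComponent (bidegree V W) d f) ↔ P = 0 := by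
      rw [hP0]
      exact Set.forall_mem_range
    rw [this]
    constructor
    · intro h
      refine MvPolynomial.funext fun x => ?_
      rw [hP, map_zero]
      exact h _ _
    · rintro rfl a b
      simpa using (hP ![a, b]).symm

/-- The vanishing ideal of an irreducible set is prime. If `f` and `g` are not in it, then both are
nonzero somewhere over one common point, and there they restrict to nonzero polynomials in the two
scaling factors. -/
theorem isPrime_vanishingIdeal {A : Set (BiProj V W)} (hA : IsIrreducible A) :
    (vanishingIdeal A).IsPrime := by
  have hne : ∀ f ∉ vanishingIdeal A, (A ∩
      {p : BiProj V W | ∀ a b : ℂ, evalAt (a • p.1.rep) (b • p.2.rep) f = 0}ᶜ).Nonempty := by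
    intro f hf
    rw [mem_vanishingIdeal] at hf
    push Not at hf
    obtain ⟨v, w, hv, hw, hmem, hne⟩ := hf
    obtain ⟨a, ha⟩ := Projectivization.exists_smul_eq_mk_rep ℂ v hv
    obtain ⟨b, hb⟩ := Projectivization.exists_smul_eq_mk_rep ℂ w hw
    refine ⟨_, hmem, fun h => hne ?_⟩
    have h1 := h (a⁻¹ : ℂˣ) (b⁻¹ : ℂˣ)
    change evalAt ((a⁻¹ : ℂˣ) • (Projectivization.mk ℂ v hv).rep)
      ((b⁻¹ : ℂˣ) • (Projectivization.mk ℂ w hw).rep) f = 0 at h1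
    rwa [← ha, ← hb, inv_smul_smul, inv_smul_smul] at h1
  refine ⟨?_, ?_⟩
  · rw [Ideal.ne_top_iff_one]
    intro h
    obtain ⟨p, hp⟩ := hA.nonempty
    obtain ⟨v, w, hv, hw, rfl⟩ := p.exists_mk
    simpa [evalAt] using h v w hv hw hp
  · intro f g hfg
    by_contra! hn
    obtain ⟨p, hpA, hf, hg⟩ := hA.isPreirreducible _ _
      (isClosed_setOf_evalAt_smul_eq_zero f).isOpen_compl
      (isClosed_setOf_evalAt_smul_eq_zero g).isOpen_compl (hne f hn.1) (hne g hn.2)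
    obtain ⟨P, hP, -⟩ := exists_polynomial_evalAt_smul f p.1.rep p.2.rep
    obtain ⟨Q, hQ, -⟩ := exists_polynomial_evalAt_smul g p.1.rep p.2.rep
    have hP0 : P ≠ 0 := by
      rintro rfl
      exact hf fun a b => by simpa using (hP ![a, b]).symm
    have hQ0 : Q ≠ 0 := by
      rintro rfl
      exact hg fun a b => by simpa using (hQ ![a, b]).symm
    -- the factors `X 0` and `X 1` keep both scalars nonzero, so that the point stays on the bi-cone
    refine mul_ne_zero (mul_ne_zero hP0 hQ0) (mul_ne_zero (MvPolynomial.X_ne_zero (0 : Fin 2))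
      (MvPolynomial.X_ne_zero (1 : Fin 2))) (MvPolynomial.funext fun x => ?_)
    rw [map_mul, map_mul, map_mul, MvPolynomial.eval_X, MvPolynomial.eval_X, hP, hQ, map_zero]
    by_cases h0 : x 0 = 0
    · simp [h0]
    by_cases h1 : x 1 = 0
    · simp [h1]
    have h2 := hfg _ _ (smul_ne_zero h0 p.1.rep_nonzero) (smul_ne_zero h1 p.2.rep_nonzero) (by
      rw [BiProj.mk_smul p.1.rep_nonzero p.2.rep_nonzero h0 h1]
      convert hpA
      exact Prod.ext p.1.mk_rep p.2.mk_rep)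
    have h3 : evalAt (x 0 • p.1.rep) (x 1 • p.2.rep) f * evalAt (x 0 • p.1.rep) (x 1 • p.2.rep) g
        = 0 := by
      rw [← h2]
      simp [evalAt]
    rw [h3, zero_mul]

end VanishingIdeal

/-! ### Transcendence degree -/

section Trdeg

universe u

/-- A proper quotient of a domain has smaller transcendence degree. Otherwise a lift of a
transcendence basis of the quotient is one of the domain, every element of the kernel is algebraic
over it, and so the kernel contains a nonzero polynomial in the lift. -/
theorem trdeg_lt_of_surjective {k : Type*} {A B : Type u} [Field k] [CommRing A]
    [IsDomain A] [CommRing B] [IsDomain B] [Algebra k A] [Algebra k B]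
    (φ : A →ₐ[k] B) (hφ : Function.Surjective φ) (hker : ¬ Function.Injective φ)
    (hA : Algebra.trdeg k A < Cardinal.aleph0) : Algebra.trdeg k B < Algebra.trdeg k A := by
  obtain ⟨s, hs⟩ := exists_isTranscendenceBasis k B
  choose g hg using hφ
  have hcomp : (φ ∘ fun b : s => g b) = Subtype.val := funext fun b => hg b
  have hs' : AlgebraicIndependent k fun b : s => g b :=
    AlgebraicIndependent.of_comp φ (by rw [hcomp]; exact hs.1)
  by_contra! hle
  rw [← hs.cardinalMk_eq_trdeg] at hle
  have hbasis := hs'.isTranscendenceBasis_of_trdeg_le hA hle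
  have halg := hbasis.isAlgebraic
  obtain ⟨y, hy, hy0⟩ : ∃ y, φ y = 0 ∧ y ≠ 0 := by
    rw [injective_iff_map_eq_zero] at hker
    push Not at hker
    exact hker
  refine Ideal.comap_ne_bot_of_algebraic_mem (I := RingHom.ker φ) hy0 hy (halg.isAlgebraic y) ?_
  rw [eq_bot_iff]
  rintro ⟨x, hx⟩ hxk
  rw [Algebra.adjoin_range_eq_range_aeval] at hx
  obtain ⟨p, rfl⟩ := hx
  have hp : MvPolynomial.aeval (Subtype.val : s → B) p = 0 := by
    rw [← hcomp]
    have h1 : φ (MvPolynomial.aeval (fun b : s => g b) p) = 0 := hxk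
    rwa [MvPolynomial.comp_aeval_apply] at h1
  have hp0 : p = 0 := hs.1 (hp.trans (map_zero _).symm)
  subst hp0
  exact Ideal.mem_bot.mpr (Subtype.ext (map_zero (MvPolynomial.aeval fun b : s => g b)))

/-- The transcendence degree is at most the size of a family that generates the field. -/
theorem trdeg_le_card_of_adjoin_eq_top {k : Type*} {K ι : Type u} [Field k] [Field K]
    [Algebra k K] [Fintype ι] (f : ι → K) (h : IntermediateField.adjoin k (Set.range f) = ⊤) :
    Algebra.trdeg k K ≤ Fintype.card ι := by
  have h1 : Algebra.IsAlgebraic (Algebra.adjoin k (Set.range f)) K := by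
    refine ⟨fun x => ?_⟩
    have hx : x ∈ IntermediateField.adjoin k (Set.range f) := h ▸ trivial
    obtain ⟨a, ha, b, hb, rfl⟩ := IntermediateField.mem_adjoin_iff_div.mp hx
    rw [div_eq_mul_inv]
    exact (isAlgebraic_algebraMap (⟨a, ha⟩ : Algebra.adjoin k (Set.range f))).mul
      (isAlgebraic_algebraMap (⟨b, hb⟩ : Algebra.adjoin k (Set.range f))).inv
  refine (Algebra.IsAlgebraic.trdeg_le_cardinalMk k (Set.range f)).trans ?_
  exact Cardinal.mk_range_le.trans (by simp)

end Trdeg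

/-! ### The dimension count over a function field -/

section FunctionField

variable {K : Type} [Field K] [Algebra ℂ K]

theorem mem_of_sum_mul_eq_zero {ι : Type*} [Fintype ι] [DecidableEq ι]
    (L : IntermediateField ℂ K) {c x : ι → K} (h : ∑ i, c i * x i = 0) {k : ι} (hk : c k ≠ 0)
    (hc : ∀ i, c i ∈ L) (hx : ∀ i, i ≠ k → x i ∈ L) : x k ∈ L := by
  rw [← Finset.add_sum_erase _ _ (Finset.mem_univ k)] at h
  have h1 : x k = (-∑ i ∈ Finset.univ.erase k, c i * x i) / c k := by
    rw [eq_div_iff hk]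
    linear_combination h
  rw [h1]
  exact L.div_mem (L.neg_mem (L.sum_mem fun i hi =>
    L.mul_mem (hc i) (hx i (Finset.ne_of_mem_erase hi)))) (hc k)

/-- If `wᵀ Q z = 0` and `Q ≠ 0`, then one of the entries of `z` and `w` is a rational function of
the others and of the entries of `Q`. -/
theorem exists_redundant_coordinate {M : ℕ} {Q : Matrix (Fin M) (Fin M) K} (hQ : Q ≠ 0)
    {y : Fin M ⊕ Fin M → K} (h : ∑ i, ∑ j, y (.inr i) * Q i j * y (.inl j) = 0) :
    ∃ k, ∀ L : IntermediateField ℂ K, (∀ i j, Q i j ∈ L) → (∀ x, x ≠ k → y x ∈ L) → y k ∈ L := by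
  by_cases hz : ∃ i, ∑ j, Q i j * y (.inl j) ≠ 0
  · obtain ⟨i₀, hi₀⟩ := hz
    refine ⟨.inr i₀, fun L hL hy => ?_⟩
    refine mem_of_sum_mul_eq_zero L (c := fun i => ∑ j, Q i j * y (.inl j))
      (x := fun i => y (.inr i)) ?_ hi₀ (fun i => ?_) fun i hi => hy _ (by simpa using hi)
    · rw [← h]
      refine Finset.sum_congr rfl fun i _ => ?_
      rw [Finset.sum_mul]
      exact Finset.sum_congr rfl fun j _ => by ring
    · exact L.sum_mem fun j _ => L.mul_mem (hL i j) (hy _ (by simp))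
  · push Not at hz
    obtain ⟨i₀, j₀, h0⟩ : ∃ i j, Q i j ≠ 0 := by
      by_contra! hall
      exact hQ (Matrix.ext hall)
    exact ⟨.inl j₀, fun L hL hy => mem_of_sum_mul_eq_zero L (c := fun j => Q i₀ j)
      (x := fun j => y (.inl j)) (hz i₀) h0 (hL i₀) fun j hj => hy _ (by simpa using hj)⟩

/-- The dimension count for the bi-cone: a nonzero matrix of rank at most `2` is determined by two
columns and by the coefficients with which they span the other `M - 2` columns, and each of the
`N` equations removes one of the `2M` coordinates of `(zₙ, wₙ)`. -/
theorem trdeg_le_of_incident {M N : ℕ} (hM : 2 ≤ M) {Q : Matrix (Fin M) (Fin M) K} (hQ : Q ≠ 0)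
    (hrank : Q.rank ≤ 2) {y : Fin N × (Fin M ⊕ Fin M) → K}
    (h : ∀ n, ∑ i, ∑ j, y (n, .inr i) * Q i j * y (n, .inl j) = 0)
    (hgen : ∀ L : IntermediateField ℂ K, (∀ i j, Q i j ∈ L) → (∀ x, y x ∈ L) → L = ⊤) :
    Algebra.trdeg ℂ K ≤ (2 * M + 2 * (M - 2) + N * (2 * M - 1) : ℕ) := by
  obtain ⟨j₁, j₂, hne, a, b, hab⟩ := exists_two_spanning_cols hrank (by simpa using hM)
  choose k hk using fun n => exists_redundant_coordinate (y := fun x => y (n, x)) hQ (h n)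
  let ι : Type := ((Fin M ⊕ Fin M) ⊕ ({j // j ≠ j₁ ∧ j ≠ j₂} ⊕ {j // j ≠ j₁ ∧ j ≠ j₂})) ⊕
    (Σ n : Fin N, {x : Fin M ⊕ Fin M // x ≠ k n})
  let f : ι → K := Sum.elim (Sum.elim (Sum.elim (fun i => Q i j₁) (fun i => Q i j₂))
    (Sum.elim (fun j => a j) (fun j => b j))) fun x => y (x.1, x.2)
  have hcard : Fintype.card ι = 2 * M + 2 * (M - 2) + N * (2 * M - 1) := by
    have h1 : Fintype.card {j // j ≠ j₁ ∧ j ≠ j₂} = M - 2 := by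
      have : Fintype.card {j // ¬ (j = j₁ ∨ j = j₂)} = M - 2 := by
        rw [Fintype.card_subtype_compl, Fintype.card_fin, Fintype.card_subtype]
        rw [show Finset.univ.filter (fun j => j = j₁ ∨ j = j₂) = {j₁, j₂} by ext; simp,
          Finset.card_pair hne]
      simpa only [not_or] using this
    have h2 : ∀ n, Fintype.card {x : Fin M ⊕ Fin M // x ≠ k n} = 2 * M - 1 := by
      intro n
      simp [Fintype.card_subtype_compl, two_mul]
    simp only [ι, Fintype.card_sum, Fintype.card_sigma, h1, h2, Fintype.card_fin, Finset.sum_const,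
      Finset.card_univ, smul_eq_mul]
    ring
  rw [← hcard]
  refine trdeg_le_card_of_adjoin_eq_top f (hgen _ ?_ ?_)
  all_goals
    have hf : ∀ t, f t ∈ IntermediateField.adjoin ℂ (Set.range f) := fun t =>
      IntermediateField.subset_adjoin _ _ ⟨t, rfl⟩
    have hQL : ∀ i j, Q i j ∈ IntermediateField.adjoin ℂ (Set.range f) := by
      intro i j
      by_cases h1 : j = j₁
      · exact h1 ▸ hf (.inl (.inl (.inl i)))
      by_cases h2 : j = j₂
      · exact h2 ▸ hf (.inl (.inl (.inr i)))
      rw [hab]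
      exact add_mem (mul_mem (hf (.inl (.inr (.inl ⟨j, h1, h2⟩)))) (hf (.inl (.inl (.inl i)))))
        (mul_mem (hf (.inl (.inr (.inr ⟨j, h1, h2⟩)))) (hf (.inl (.inl (.inr i)))))
  · exact hQL
  · rintro ⟨n, x⟩
    have hx : ∀ x, x ≠ k n → y (n, x) ∈ IntermediateField.adjoin ℂ (Set.range f) :=
      fun x hx => hf (.inr ⟨n, x, hx⟩)
    by_cases hxk : x = k n
    · rw [hxk]
      exact hk n _ hQL hx
    · exact hx x hxk

end FunctionField

/-! ### Closedness and the upper bound -/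

section UpperBound

open MvPolynomial (X C)

/-- The coordinate ring of a bi-cone has transcendence degree at least `2`: a coordinate on each
factor that is nonzero at one point gives two independent elements, because of the two scalings. -/
theorem two_le_trdeg {V W : Type} [AddCommGroup V] [Module ℂ V] [AddCommGroup W] [Module ℂ W]
    {A : Set (BiProj V W)} (hA : A.Nonempty) :
    2 ≤ Algebra.trdeg ℂ (CoordPoly V W ⧸ vanishingIdeal A) := by
  obtain ⟨p, hp⟩ := hA
  obtain ⟨v, w, hv, hw, rfl⟩ := p.exists_mk
  obtain ⟨l, hl⟩ : ∃ l : Module.Dual ℂ V, l v ≠ 0 := by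
    by_contra! h
    exact hv ((Module.forall_dual_apply_eq_zero_iff ℂ v).mp h)
  obtain ⟨m, hm⟩ : ∃ m : Module.Dual ℂ W, m w ≠ 0 := by
    by_contra! h
    exact hw ((Module.forall_dual_apply_eq_zero_iff ℂ w).mp h)
  let g : Fin 2 → CoordPoly V W := ![X (.inl l), X (.inr m)]
  have hind : AlgebraicIndependent ℂ
      ((Ideal.Quotient.mkₐ ℂ (vanishingIdeal A)) ∘ g) := by
    rw [algebraicIndependent_iff]
    intro F hF
    have hF' : Ideal.Quotient.mkₐ ℂ (vanishingIdeal A) (MvPolynomial.aeval g F) = 0 := by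
      rw [MvPolynomial.comp_aeval_apply]
      exact hF
    have hmem : MvPolynomial.aeval g F ∈ vanishingIdeal A := Ideal.Quotient.eq_zero_iff_mem.mp hF'
    have heval : ∀ a b, evalAt (a • v) (b • w) (MvPolynomial.aeval g F) =
        MvPolynomial.eval ![a * l v, b * m w] F := by
      intro a b
      unfold evalAt
      rw [MvPolynomial.aeval_def, MvPolynomial.algebraMap_eq, MvPolynomial.eval_eval₂,
        MvPolynomial.eval]
      congr 1
      · ext; simp
      · ext i
        fin_cases i <;> simp [g]
    by_contra hF0
    -- as the scalars have to be nonzero, `F * (X 0 * X 1)` is shown to vanish in place of `F`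
    refine mul_ne_zero hF0 (mul_ne_zero (MvPolynomial.X_ne_zero (0 : Fin 2))
      (MvPolynomial.X_ne_zero (1 : Fin 2))) (MvPolynomial.funext fun x => ?_)
    rw [map_mul, map_mul, MvPolynomial.eval_X, MvPolynomial.eval_X, map_zero]
    by_cases h0 : x 0 = 0
    · simp [h0]
    by_cases h1 : x 1 = 0
    · simp [h1]
    have ha := div_ne_zero h0 hl
    have hb := div_ne_zero h1 hm
    have h2 := hmem _ _ (smul_ne_zero ha hv) (smul_ne_zero hb hw)
      (by rw [BiProj.mk_smul hv hw ha hb]; exact hp)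
    rw [heval, div_mul_cancel₀ _ hl, div_mul_cancel₀ _ hm] at h2
    have hx : ![x 0, x 1] = x := by
      ext i
      fin_cases i <;> rfl
    rw [hx] at h2
    rw [h2, zero_mul]
  simpa using hind.lift_cardinalMk_le_trdeg

/-- The transcendence degree of the coordinate ring of a bi-cone is strictly monotone on irreducible
sets, as long as the vanishing ideal tells the sets apart. -/
theorem trdeg_lt_of_subset {V W : Type} [AddCommGroup V] [Module ℂ V] [AddCommGroup W]
    [Module ℂ W] {A B : Set (BiProj V W)} (hA : IsIrreducible A) (hB : IsIrreducible B)
    (hAB : A ⊆ B) (hne : ¬ vanishingIdeal A ≤ vanishingIdeal B)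
    (hfin : Algebra.trdeg ℂ (CoordPoly V W ⧸ vanishingIdeal B) < Cardinal.aleph0) :
    Algebra.trdeg ℂ (CoordPoly V W ⧸ vanishingIdeal A) <
      Algebra.trdeg ℂ (CoordPoly V W ⧸ vanishingIdeal B) := by
  have := isPrime_vanishingIdeal hA
  have := isPrime_vanishingIdeal hB
  refine trdeg_lt_of_surjective (Ideal.Quotient.factorₐ ℂ (vanishingIdeal_anti hAB))
    (Ideal.Quotient.factor_surjective (vanishingIdeal_anti hAB)) (fun hinj => hne fun f hf => ?_) hfin
  rw [← Ideal.Quotient.eq_zero_iff_mem] at hf ⊢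
  exact hinj (hf.trans (map_zero _).symm)

theorem mk_mem_varietyB_iff {M N : ℕ} {v : FramePair M N} {w : SymSkewPair M} (hv : v ≠ 0)
    (hw : w ≠ 0) : BiProj.mk hv hw ∈ varietyB M N ↔
      (Matrix.of fun i j => (pairBasis M).coord (i, j) w).rank ≤ 2 ∧
      ∀ n, ∑ i, ∑ j, (frameBasis M N).coord (n, .inr i) v * (pairBasis M).coord (i, j) w *
        (frameBasis M N).coord (n, .inl j) v = 0 :=
  (mk_mem_varietyB hv hw).trans (incident_iff v w)

variable (M N : ℕ)

/-- The matrix `Q = X + iY` with the linear coordinates as entries. -/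
def genericMatrix : Matrix (Fin M) (Fin M) (CoordPoly (FramePair M N) (SymSkewPair M)) :=
  Matrix.of fun i j => X (.inr ((pairBasis M).coord (i, j)))

/-- The equation `wₙᵀ Q zₙ` in the linear coordinates. -/
def incidencePoly (n : Fin N) : CoordPoly (FramePair M N) (SymSkewPair M) :=
  ∑ i, ∑ j, X (.inl ((frameBasis M N).coord (n, .inr i))) * genericMatrix M N i j *
    X (.inl ((frameBasis M N).coord (n, .inl j)))

variable {M N}

theorem evalAt_incidencePoly (v : FramePair M N) (w : SymSkewPair M) (n : Fin N) :
    evalAt v w (incidencePoly M N n) =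
      ∑ i, ∑ j, (frameBasis M N).coord (n, .inr i) v * (pairBasis M).coord (i, j) w *
        (frameBasis M N).coord (n, .inl j) v := by
  simp [evalAt, incidencePoly, genericMatrix]

theorem evalAt_minor (v : FramePair M N) (w : SymSkewPair M) {k : ℕ} (r c : Fin k → Fin M) :
    evalAt v w ((genericMatrix M N).submatrix r c).det =
      ((Matrix.of fun i j => (pairBasis M).coord (i, j) w).submatrix r c).det := by
  unfold evalAt
  rw [RingHom.map_det]
  congr 1
  ext i j
  simp [genericMatrix]

theorem mem_varietyB_iff_evalAt {v : FramePair M N} {w : SymSkewPair M} (hv : v ≠ 0)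
    (hw : w ≠ 0) : BiProj.mk hv hw ∈ varietyB M N ↔
      (∀ r c : Fin 3 → Fin M, evalAt v w ((genericMatrix M N).submatrix r c).det = 0) ∧
      ∀ n, evalAt v w (incidencePoly M N n) = 0 := by
  rw [mk_mem_varietyB_iff, rank_le_iff_minors_eq_zero]
  simp only [evalAt_minor, evalAt_incidencePoly]

/-- The coordinate ring of the bi-cone over an irreducible part of the variety has transcendence
degree at most `2MN - N + 4M - 4`. -/
theorem trdeg_le_of_subset_varietyB (hM : 2 ≤ M)
    {A : Set (BiProj (FramePair M N) (SymSkewPair M))} (hA : IsIrreducible A)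
    (hsub : A ⊆ varietyB M N) :
    Algebra.trdeg ℂ (CoordPoly (FramePair M N) (SymSkewPair M) ⧸ vanishingIdeal A) ≤
      (2 * M + 2 * (M - 2) + N * (2 * M - 1) : ℕ) := by
  have hprime := isPrime_vanishingIdeal hA
  -- `Q` and the `zₙ`, `wₙ` are read off in the function field, where the relations on `A` hold
  let R := CoordPoly (FramePair M N) (SymSkewPair M) ⧸ vanishingIdeal A
  let K := FractionRing R
  let ψ : R →ₐ[ℂ] K := IsScalarTower.toAlgHom ℂ R K
  have hψ : Function.Injective ψ := IsFractionRing.injective R K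
  let φ : CoordPoly (FramePair M N) (SymSkewPair M) →ₐ[ℂ] K :=
    ψ.comp (Ideal.Quotient.mkₐ ℂ (vanishingIdeal A))
  have hφ : ∀ f, φ f = 0 ↔ f ∈ vanishingIdeal A := fun f =>
    (map_eq_zero_iff ψ hψ).trans Ideal.Quotient.eq_zero_iff_mem
  refine (trdeg_le_of_injective ψ hψ).trans ?_
  refine trdeg_le_of_incident hM (Q := (genericMatrix M N).map φ)
    (y := fun x => φ (X (.inl ((frameBasis M N).coord x)))) ?_ ?_ ?_ ?_
  · intro h0
    obtain ⟨p, hp⟩ := hA.nonempty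
    obtain ⟨v, w, hv, hw, rfl⟩ := p.exists_mk
    refine hw ((pairBasis M).forall_coord_eq_zero_iff.mp fun ⟨i, j⟩ => ?_)
    have h1 : φ (genericMatrix M N i j) = 0 := congrFun (congrFun h0 i) j
    simpa [genericMatrix, evalAt] using (hφ _).mp h1 v w hv hw hp
  · rw [rank_le_iff_minors_eq_zero]
    intro r c
    have h1 : ((genericMatrix M N).submatrix r c).det ∈ vanishingIdeal A :=
      fun v w hv hw hp => ((mem_varietyB_iff_evalAt hv hw).mp (hsub hp)).1 r c
    rw [← hφ, AlgHom.map_det] at h1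
    exact h1
  · intro n
    have h1 : incidencePoly M N n ∈ vanishingIdeal A :=
      fun v w hv hw hp => ((mem_varietyB_iff_evalAt hv hw).mp (hsub hp)).2 n
    rw [← hφ] at h1
    simpa [incidencePoly] using h1
  · intro L hQ hy
    have hX : ∀ s, φ (X s) ∈ L := by
      rintro (l | l)
      · have h1 : X (.inl l) - ∑ x, C (l (frameBasis M N x)) *
            X (.inl ((frameBasis M N).coord x)) ∈ vanishingIdeal A := by
          intro v w hv hw _
          have h2 := congrArg l ((frameBasis M N).sum_repr v)
          rw [map_sum] at h2
          simp only [map_smul, smul_eq_mul] at h2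
          simp only [evalAt, map_sub, map_sum, map_mul, MvPolynomial.eval_X, MvPolynomial.eval_C,
            Sum.elim_inl, Module.Basis.coord_apply, ← h2, mul_comm, sub_self]
        rw [← hφ, map_sub, sub_eq_zero] at h1
        rw [h1, map_sum]
        refine L.sum_mem fun x _ => ?_
        rw [map_mul]
        refine L.mul_mem ?_ (hy x)
        rw [← MvPolynomial.algebraMap_eq, AlgHom.commutes]
        exact L.algebraMap_mem _
      · have h1 : X (.inr l) - ∑ x, C (l (pairBasis M x)) *
            X (.inr ((pairBasis M).coord x)) ∈ vanishingIdeal A := by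
          intro v w hv hw _
          have h2 := congrArg l ((pairBasis M).sum_repr w)
          rw [map_sum] at h2
          simp only [map_smul, smul_eq_mul] at h2
          simp only [evalAt, map_sub, map_sum, map_mul, MvPolynomial.eval_X, MvPolynomial.eval_C,
            Sum.elim_inr, Module.Basis.coord_apply, ← h2, mul_comm, sub_self]
        rw [← hφ, map_sub, sub_eq_zero] at h1
        rw [h1, map_sum]
        refine L.sum_mem fun x _ => ?_
        rw [map_mul]
        refine L.mul_mem ?_ (hQ x.1 x.2)
        rw [← MvPolynomial.algebraMap_eq, AlgHom.commutes]
        exact L.algebraMap_mem _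
    have hall : ∀ f, φ f ∈ L := by
      intro f
      induction f using MvPolynomial.induction_on with
      | C a =>
        rw [← MvPolynomial.algebraMap_eq, AlgHom.commutes]
        exact L.algebraMap_mem _
      | add p q hp hq => rw [map_add]; exact L.add_mem hp hq
      | mul_X p s hp => rw [map_mul]; exact L.mul_mem hp (hX s)
    rw [eq_top_iff]
    rintro x -
    obtain ⟨a, b, -, rfl⟩ := IsFractionRing.div_surjective (A := R) x
    obtain ⟨f, rfl⟩ := Ideal.Quotient.mk_surjective a
    obtain ⟨g, rfl⟩ := Ideal.Quotient.mk_surjective b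
    exact L.div_mem (hall f) (hall g)

/-- The transcendence degree of the coordinate ring of the bi-cone is a strictly monotone function
on the irreducible closed subsets; it takes values between `2` and `2MN - N + 4M - 4`. -/
theorem topologicalKrullDim_varietyB_le (hM : 2 ≤ M) :
    topologicalKrullDim (varietyB M N) ≤
      ((2 * M + 2 * (M - 2) + N * (2 * M - 1) - 2 : ℕ) : WithBot ℕ∞) := by
  set D := 2 * M + 2 * (M - 2) + N * (2 * M - 1) with hD
  let S : TopologicalSpace.IrreducibleCloseds (varietyB M N) →
      Set (BiProj (FramePair M N) (SymSkewPair M)) := fun Z => Subtype.val '' (Z : Set (varietyB M N))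
  have hirr : ∀ Z, IsIrreducible (S Z) := fun Z =>
    Z.isIrreducible.image _ continuous_subtype_val.continuousOn
  have hsub : ∀ Z, S Z ⊆ varietyB M N := fun Z => Subtype.coe_image_subset _ _
  let t := fun Z => Algebra.trdeg ℂ (CoordPoly (FramePair M N) (SymSkewPair M) ⧸
    vanishingIdeal (S Z))
  have hle : ∀ Z, t Z ≤ D := fun Z => trdeg_le_of_subset_varietyB hM (hirr Z) (hsub Z)
  have hfin : ∀ Z, t Z < Cardinal.aleph0 := fun Z =>
    (hle Z).trans_lt (Cardinal.natCast_lt_aleph0)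
  have hge : ∀ Z, 2 ≤ t Z := fun Z => two_le_trdeg (hirr Z).nonempty
  have hcast : ∀ Z, ((t Z).toNat : Cardinal) = t Z := fun Z =>
    Cardinal.cast_toNat_of_lt_aleph0 (hfin Z)
  have hle' : ∀ Z, (t Z).toNat ≤ D := fun Z => by
    have := hle Z
    rw [← hcast] at this
    exact_mod_cast this
  have hge' : ∀ Z, 2 ≤ (t Z).toNat := fun Z => by
    have := hge Z
    rw [← hcast] at this
    exact_mod_cast this
  have hmono : ∀ Y Z, Y < Z → (t Y).toNat < (t Z).toNat := by
    intro Y Z hYZ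
    have h1 : t Y < t Z := by
      refine trdeg_lt_of_subset (hirr Y) (hirr Z) (Set.image_mono hYZ.le) (fun hI => ?_) (hfin Z)
      refine hYZ.not_ge fun x hx => ?_
      -- a closed set of the ambient product that cuts out `Y` also contains `Z`
      obtain ⟨C, hC, hCY⟩ := isClosed_induced_iff.mp Y.isClosed
      have h2 : S Y ⊆ C := by
        rintro _ ⟨x, hx, rfl⟩
        rw [← hCY] at hx
        exact hx
      have h3 := subset_of_vanishingIdeal_le hC ((vanishingIdeal_anti h2).trans hI) ⟨x, hx, rfl⟩
      have h4 : x ∈ (Y : Set (varietyB M N)) := by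
        rw [← hCY]
        exact h3
      exact h4
    rw [← hcast Y, ← hcast Z] at h1
    exact_mod_cast h1
  refine (Order.krullDim_le_of_strictMono
    (fun Z => (⟨(t Z).toNat - 2, by have := hle' Z; omega⟩ : Fin (D - 2 + 1)))
    fun Y Z hYZ => ?_).trans ?_
  · have h1 := hmono Y Z hYZ
    have h2 := hge' Y
    exact Fin.mk_lt_mk.mpr (by omega)
  · refine iSup_le fun l => ?_
    have := l.length_lt_card
    rw [Fintype.card_fin] at this
    exact_mod_cast Nat.lt_succ_iff.mp this

theorem isClosed_varietyB : IsClosed (varietyB M N) := by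
  have hX : ∀ l, (X (.inl l) : CoordPoly (FramePair M N) (SymSkewPair M)).IsWeightedHomogeneous
      (bidegree _ _) (1, 0) := fun l => MvPolynomial.isWeightedHomogeneous_X ℂ _ _
  have hG : ∀ i j, (genericMatrix M N i j).IsWeightedHomogeneous (bidegree _ _) (0, 1) :=
    fun i j => MvPolynomial.isWeightedHomogeneous_X ℂ _ _
  have hS : ∀ f ∈ {f : CoordPoly (FramePair M N) (SymSkewPair M) | (∃ r c : Fin 3 → Fin M,
      f = ((genericMatrix M N).submatrix r c).det) ∨ ∃ n, f = incidencePoly M N n},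
      IsBihomogeneous f := by
    rintro f (⟨r, c, rfl⟩ | ⟨n, rfl⟩)
    · refine ⟨0, 3, ?_⟩
      rw [Matrix.det_apply']
      refine MvPolynomial.IsWeightedHomogeneous.sum _ _ _ fun σ _ => ?_
      have h1 := MvPolynomial.IsWeightedHomogeneous.prod Finset.univ
        (fun i => (genericMatrix M N).submatrix r c (σ i) i) (fun _ => ((0, 1) : ℕ × ℕ))
        (w := bidegree _ _) fun i _ => hG _ _
      have h2 := (MvPolynomial.isWeightedHomogeneous_C (R := ℂ)
        (bidegree (FramePair M N) (SymSkewPair M)) ((Equiv.Perm.sign σ : ℤ) : ℂ)).mul h1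
      simpa using h2
    · refine ⟨2, 1, ?_⟩
      refine MvPolynomial.IsWeightedHomogeneous.sum _ _ _ fun i _ =>
        MvPolynomial.IsWeightedHomogeneous.sum _ _ _ fun j _ => ?_
      exact ((hX _).mul (hG i j)).mul (hX _)
  refine isClosed_iff.mpr ⟨_, hS, ?_⟩
  ext p
  obtain ⟨v, w, hv, hw, rfl⟩ := p.exists_mk
  rw [mem_varietyB_iff_evalAt hv hw]
  refine Iff.trans ?_ (mk_mem_zeroLocus hS hv hw).symm
  constructor
  · rintro ⟨h1, h2⟩ f (⟨r, c, rfl⟩ | ⟨n, rfl⟩)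
    exacts [h1 r c, h2 n]
  · exact fun h => ⟨fun r c => h _ (.inl ⟨r, c, rfl⟩), fun n => h _ (.inr ⟨n, rfl⟩)⟩

end UpperBound

/-! ### Polynomial families of points -/

section PolynomialFamilies

/-- The algebra of polynomial functions of the parameters `t : ι → ℂ`. -/
def polyFun (ι : Type*) : Subalgebra ℂ ((ι → ℂ) → ℂ) :=
  (MvPolynomial.aeval fun (i : ι) (t : ι → ℂ) => t i).range

variable {ι : Type*}

theorem mem_polyFun_iff {f : (ι → ℂ) → ℂ} :
    f ∈ polyFun ι ↔ ∃ P : MvPolynomial ι ℂ, ∀ t, f t = MvPolynomial.eval t P := by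
  have h : ∀ (P : MvPolynomial ι ℂ) t,
      MvPolynomial.aeval (fun (i : ι) (t : ι → ℂ) => t i) P t = MvPolynomial.eval t P := by
    intro P t
    have := MvPolynomial.comp_aeval_apply (R := ℂ) (fun (i : ι) (t : ι → ℂ) => t i)
      (Pi.evalAlgHom ℂ (fun _ : ι → ℂ => ℂ) t) P
    simpa [MvPolynomial.aeval_eq_eval] using this
  constructor
  · rintro ⟨P, rfl⟩
    exact ⟨P, h P⟩
  · rintro ⟨P, hP⟩
    exact ⟨P, funext fun t => (h P t).trans (hP t).symm⟩

theorem coord_mem_polyFun (i : ι) : (fun t : ι → ℂ => t i) ∈ polyFun ι :=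
  mem_polyFun_iff.mpr ⟨MvPolynomial.X i, fun _ => (MvPolynomial.eval_X i).symm⟩

theorem const_mem_polyFun (c : ℂ) : (fun _ : ι → ℂ => c) ∈ polyFun ι :=
  (polyFun ι).algebraMap_mem c

theorem add_mem_polyFun {f g : (ι → ℂ) → ℂ} (hf : f ∈ polyFun ι) (hg : g ∈ polyFun ι) :
    (fun t => f t + g t) ∈ polyFun ι := add_mem hf hg

theorem mul_mem_polyFun {f g : (ι → ℂ) → ℂ} (hf : f ∈ polyFun ι) (hg : g ∈ polyFun ι) :
    (fun t => f t * g t) ∈ polyFun ι := mul_mem hf hg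

theorem sum_mem_polyFun {κ : Type*} {s : Finset κ} {f : κ → (ι → ℂ) → ℂ}
    (hf : ∀ k, f k ∈ polyFun ι) : (fun t => ∑ k ∈ s, f k t) ∈ polyFun ι := by
  have h := sum_mem fun k (_ : k ∈ s) => hf k
  convert h using 1
  ext t
  simp

theorem eval_mem_polyFun {σ : Type*} {g : σ → (ι → ℂ) → ℂ} (hg : ∀ s, g s ∈ polyFun ι)
    (P : MvPolynomial σ ℂ) : (fun t => MvPolynomial.eval (fun s => g s t) P) ∈ polyFun ι := by
  induction P using MvPolynomial.induction_on with
  | C a => simpa using const_mem_polyFun a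
  | add p q hp hq => simpa using add_mem_polyFun hp hq
  | mul_X p s hp => simpa using mul_mem_polyFun hp (hg s)

theorem comp_mem_polyFun {f : (ι → ℂ) → ℂ} (hf : f ∈ polyFun ι) {ψ : (ι → ℂ) → ι → ℂ}
    (hψ : ∀ i, (fun t => ψ t i) ∈ polyFun ι) : (fun t => f (ψ t)) ∈ polyFun ι := by
  obtain ⟨P, hP⟩ := mem_polyFun_iff.mp hf
  simp only [hP]
  exact eval_mem_polyFun hψ P

theorem dual_mem_polyFun {κ V : Type*} [Fintype κ] [AddCommGroup V] [Module ℂ V]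
    (b : Module.Basis κ ℂ V) {v : (ι → ℂ) → V} (hv : ∀ k, (fun t => b.coord k (v t)) ∈ polyFun ι)
    (l : Module.Dual ℂ V) : (fun t => l (v t)) ∈ polyFun ι := by
  have h : ∀ t, l (v t) = ∑ k, b.coord k (v t) * l (b k) := by
    intro t
    have h2 := congrArg l (b.sum_repr (v t))
    rw [map_sum] at h2
    simpa using h2.symm
  simp only [h]
  exact sum_mem_polyFun fun k => mul_mem_polyFun (hv k) (const_mem_polyFun _)

variable {V W : Type*} [AddCommGroup V] [Module ℂ V] [AddCommGroup W] [Module ℂ W]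

/-- A family of points of `ℙ(V) × ℙ(W)` whose homogeneous coordinates are polynomials in free
parameters is irreducible: a product of nonzero polynomials is nonzero. -/
theorem isIrreducible_range_mk {v : (ι → ℂ) → V} {w : (ι → ℂ) → W} (hv : ∀ t, v t ≠ 0)
    (hw : ∀ t, w t ≠ 0) (hvp : ∀ l : Module.Dual ℂ V, (fun t => l (v t)) ∈ polyFun ι)
    (hwp : ∀ l : Module.Dual ℂ W, (fun t => l (w t)) ∈ polyFun ι) :
    IsIrreducible (Set.range fun t => BiProj.mk (hv t) (hw t)) := by
  refine ⟨Set.range_nonempty _, isPreirreducible_iff_isClosed_union_isClosed.mpr ?_⟩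
  intro Z₁ Z₂ hZ₁ hZ₂ hsub
  obtain ⟨S₁, hS₁, rfl⟩ := isClosed_iff.mp hZ₁
  obtain ⟨S₂, hS₂, rfl⟩ := isClosed_iff.mp hZ₂
  have hpoly : ∀ f : CoordPoly V W, ∃ P : MvPolynomial ι ℂ,
      ∀ t, evalAt (v t) (w t) f = MvPolynomial.eval t P := by
    intro f
    refine mem_polyFun_iff.mp ?_
    have hg : ∀ s : Module.Dual ℂ V ⊕ Module.Dual ℂ W,
        (fun t => Sum.elim (fun l : Module.Dual ℂ V => l (v t))
          (fun l : Module.Dual ℂ W => l (w t)) s) ∈ polyFun ι := by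
      rintro (l | l)
      exacts [hvp l, hwp l]
    exact eval_mem_polyFun hg f
  have hex : ∀ S : Set (CoordPoly V W), (∀ f ∈ S, IsBihomogeneous f) →
      ¬ Set.range (fun t => BiProj.mk (hv t) (hw t)) ⊆ zeroLocus S →
      ∃ P : MvPolynomial ι ℂ, P ≠ 0 ∧
        ∀ t, BiProj.mk (hv t) (hw t) ∈ zeroLocus S → MvPolynomial.eval t P = 0 := by
    intro S hS hn
    rw [Set.not_subset] at hn
    obtain ⟨_, ⟨t, rfl⟩, ht⟩ := hn
    have h1 := mt (mk_mem_zeroLocus hS (hv t) (hw t)).mpr ht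
    push Not at h1
    obtain ⟨f, hf, hft⟩ := h1
    obtain ⟨P, hP⟩ := hpoly f
    refine ⟨P, ?_, fun t' ht' => ?_⟩
    · rintro rfl
      exact hft (by simp [hP])
    · rw [← hP]
      exact (mk_mem_zeroLocus hS (hv t') (hw t')).mp ht' f hf
  by_contra! hn
  obtain ⟨P, hP0, hP⟩ := hex S₁ hS₁ hn.1
  obtain ⟨Q, hQ0, hQ⟩ := hex S₂ hS₂ hn.2
  refine mul_ne_zero hP0 hQ0 (MvPolynomial.funext fun t => ?_)
  rw [map_mul, map_zero, mul_eq_zero]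
  exact (hsub ⟨t, rfl⟩).imp (hP t) (hQ t)

end PolynomialFamilies

/-! ### Chains of irreducible closed sets -/

section Chains

theorem isIrreducible_of_image_val {X : Type*} [TopologicalSpace X] {B : Set X} {S : Set B}
    (h : IsIrreducible (Subtype.val '' S)) : IsIrreducible S := by
  refine ⟨Set.image_nonempty.mp h.nonempty, ?_⟩
  rintro U U' hU hU' ⟨x, hxS, hx⟩ ⟨y, hyS, hy⟩
  obtain ⟨O, hO, rfl⟩ := isOpen_induced_iff.mp hU
  obtain ⟨O', hO', rfl⟩ := isOpen_induced_iff.mp hU'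
  obtain ⟨_, ⟨z, hz, rfl⟩, hzO⟩ := h.isPreirreducible O O' hO hO' ⟨x, ⟨x, hxS, rfl⟩, hx⟩
    ⟨y, ⟨y, hyS, rfl⟩, hy⟩
  exact ⟨z, hz, hzO⟩

/-- A lower bound for the dimension from a family of points with independent parameters. The
parameters are switched on one after the other, in the order of their levels, and the closures of
the subfamilies form a chain. It is strict if for each parameter `i` a closed set `C i` contains
all members with `t i = 0`, but not those with `t i = 1` at which the parameters of lower level are
`1` and those of higher level are `0`. -/
theorem card_le_topologicalKrullDim {X ι : Type*} [TopologicalSpace X] [Fintype ι]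
    [DecidableEq ι] (φ : (ι → ℂ) → X)
    (hirr : ∀ s : Finset ι,
      IsIrreducible (Set.range fun t : ι → ℂ => φ fun i => if i ∈ s then t i else 0))
    (lev : ι → ℕ) (C : ι → Set X) (hC : ∀ i, IsClosed (C i))
    (hzero : ∀ i t, t i = 0 → φ t ∈ C i)
    (hone : ∀ i t, t i = 1 → (∀ j, lev j < lev i → t j = 1) → (∀ j, lev i < lev j → t j = 0) →
      φ t ∉ C i) :
    (Fintype.card ι : WithBot ℕ∞) ≤ topologicalKrullDim X := by
  set n := Fintype.card ι with hn
  -- an enumeration of the parameters by increasing level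
  obtain ⟨σ, hσ⟩ : ∃ σ : Fin n ≃ ι, Monotone (lev ∘ σ) :=
    ⟨(Tuple.sort (lev ∘ (Fintype.equivFin ι).symm)).trans (Fintype.equivFin ι).symm,
      Tuple.monotone_sort (lev ∘ (Fintype.equivFin ι).symm)⟩
  have hlt : ∀ i j, lev i < lev j → σ.symm i < σ.symm j := by
    intro i j hij
    by_contra! hle
    have := hσ hle
    simp only [Function.comp_apply, Equiv.apply_symm_apply] at this
    omega
  let s : ℕ → Finset ι := fun k => Finset.univ.filter fun i => (σ.symm i).val < k
  let Z : Fin (n + 1) → TopologicalSpace.IrreducibleCloseds X := fun k =>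
    ⟨closure (Set.range fun t : ι → ℂ => φ fun i => if i ∈ s k then t i else 0),
      isIrreducible_iff_closure.mpr (hirr _), isClosed_closure⟩
  have hZ : StrictMono Z := by
    refine Fin.strictMono_iff_lt_succ.mpr fun k => lt_of_le_of_ne ?_ fun heq => ?_
    · refine closure_mono ?_
      rintro _ ⟨t, rfl⟩
      refine ⟨fun i => if i ∈ s k then t i else 0, congrArg φ (funext fun i => ?_)⟩
      by_cases h1 : i ∈ s k
      · have h2 : i ∈ s (k + 1) := by
          simp only [s, Finset.mem_filter, Finset.mem_univ, true_and] at h1 ⊢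
          omega
        simp [h1, h2]
      · simp [h1]
    · have h1 : (Z k.castSucc : Set X) ⊆ C (σ k) := by
        refine closure_minimal ?_ (hC _)
        rintro _ ⟨t, rfl⟩
        exact hzero _ _ (by simp [s])
      have h2 : φ (fun i => if i ∈ s (k + 1) then 1 else 0) ∈ (Z k.succ : Set X) :=
        subset_closure ⟨fun _ => 1, by simp⟩
      rw [← heq] at h2
      refine hone (σ k) _ ?_ (fun j hj => ?_) (fun j hj => ?_) (h1 h2)
      · simp [s]
      · have := hlt _ _ hj
        rw [Equiv.symm_apply_apply] at this
        have h3 : j ∈ s (k + 1) := by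
          simp only [s, Finset.mem_filter, Finset.mem_univ, true_and]
          omega
        simp [h3]
      · have := hlt _ _ hj
        rw [Equiv.symm_apply_apply] at this
        have h3 : j ∉ s (k + 1) := by
          simp only [s, Finset.mem_filter, Finset.mem_univ, true_and]
          omega
        simp [h3]
  exact Order.le_krullDim_iff.mpr ⟨LTSeries.mk n Z hZ, rfl⟩

end Chains

/-! ### The parametrized family and the lower bound -/

section Parametrization

open MvPolynomial (X)

variable (m n : ℕ)

/-- The parameters of a full-dimensional family of points of the variety for `M = m + 2` and
`N = n + 1`. -/
inductive Param
  /-- the entries of the `z_n` other than the first one of `z_0`, which is set to `1` -/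
  | z (x : {x : Fin (n + 1) × Fin (m + 2) // x ≠ (0, 0)})
  /-- the entries of `w_n` after the first, up to the factor `(Q z_n)_0` -/
  | w (x : Fin (n + 1) × Fin (m + 1))
  /-- the first column of `Q` below the entry `Q 0 0 = 1` -/
  | col (i : Fin (m + 1))
  /-- the first row of `Q` after the entry `Q 0 0 = 1` -/
  | row (j : Fin (m + 1))
  /-- the column vector of the second summand of `Q`, which starts with `0` -/
  | col₂ (i : Fin (m + 1))
  /-- the row vector of the second summand of `Q`, which starts with `0, 1` -/
  | row₂ (j : Fin m)

variable {m n}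

namespace Param

/-- The order in which the parameters are switched on. The test polynomials of `w` and `row₂` equal
the parameter only when `Q z_n` and `col₂ 0` have suitable values, which this order ensures. -/
def level : Param m n → ℕ
  | z _ => 0
  | w _ => 1
  | col _ => 2
  | row _ => 2
  | col₂ _ => 3
  | row₂ _ => 4

/-- The parameters as a disjoint union of index types, for counting them. -/
def equivSum : Param m n ≃
    ({x : Fin (n + 1) × Fin (m + 2) // x ≠ (0, 0)} ⊕ Fin (n + 1) × Fin (m + 1)) ⊕
      ((Fin (m + 1) ⊕ Fin (m + 1)) ⊕ (Fin (m + 1) ⊕ Fin m)) where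
  toFun
    | z x => .inl (.inl x)
    | w x => .inl (.inr x)
    | col i => .inr (.inl (.inl i))
    | row i => .inr (.inl (.inr i))
    | col₂ i => .inr (.inr (.inl i))
    | row₂ i => .inr (.inr (.inr i))
  invFun := Sum.elim (Sum.elim z w) (Sum.elim (Sum.elim col row) (Sum.elim col₂ row₂))
  left_inv p := by cases p <;> rfl
  right_inv p := by rcases p with (p | p) | ((p | p) | (p | p)) <;> rfl

instance : Fintype (Param m n) := Fintype.ofEquiv _ equivSum.symm

theorem card : Fintype.card (Param m n) =
    ((n + 1) * (m + 2) - 1 + (n + 1) * (m + 1)) + (3 * (m + 1) + m) := by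
  rw [Fintype.card_congr equivSum]
  simp [Fintype.card_subtype_compl]
  ring

end Param

variable (t : Param m n → ℂ)

/-- The vectors `z_n`. -/
def zParam (k : Fin (n + 1)) (i : Fin (m + 2)) : ℂ :=
  if h : (k, i) ≠ (0, 0) then t (.z ⟨(k, i), h⟩) else 1

/-- The column vector of the first summand of `Q`. -/
def colParam : Fin (m + 2) → ℂ := Fin.cons 1 fun i => t (.col i)

/-- The row vector of the first summand of `Q`. -/
def rowParam : Fin (m + 2) → ℂ := Fin.cons 1 fun j => t (.row j)

/-- The column vector of the second summand of `Q`. -/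
def colParam₂ : Fin (m + 2) → ℂ := Fin.cons 0 fun i => t (.col₂ i)

/-- The row vector of the second summand of `Q`. -/
def rowParam₂ : Fin (m + 2) → ℂ := Fin.cons 0 (Fin.cons 1 fun j => t (.row₂ j))

/-- The matrix `Q`, a sum of two matrices of rank at most `1`. -/
def matParam (i j : Fin (m + 2)) : ℂ :=
  colParam t i * rowParam t j + colParam₂ t i * rowParam₂ t j

/-- The vectors `Q z_n`. -/
def imageParam (k : Fin (n + 1)) (i : Fin (m + 2)) : ℂ :=
  ∑ j, matParam t i j * zParam t k j

/-- The vectors `w_n`, parametrized so that `wₙᵀ Q zₙ = 0`. -/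
def wParam (k : Fin (n + 1)) : Fin (m + 2) → ℂ :=
  Fin.cons (-∑ i, t (.w (k, i)) * imageParam t k i.succ) fun i => t (.w (k, i)) * imageParam t k 0

/-- The pair `(U, V)` with the coordinates `z_n`, `w_n`. -/
def frameParam : FramePair (m + 2) (n + 1) :=
  (frameEquiv (m + 2) (n + 1)).symm fun x => Sum.elim (zParam t x.1) (wParam t x.1) x.2

/-- The pair `(X, Y)` with `X + iY = Q`. -/
def pairParam : SymSkewPair (m + 2) :=
  (pairEquiv (m + 2)).symm fun x => matParam t x.1 x.2

@[simp] theorem coord_frameParam (x : Fin (n + 1) × (Fin (m + 2) ⊕ Fin (m + 2))) :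
    (frameBasis (m + 2) (n + 1)).coord x (frameParam t) =
      Sum.elim (zParam t x.1) (wParam t x.1) x.2 := by
  simp [frameBasis, frameParam]

@[simp] theorem coord_pairParam (x : Fin (m + 2) × Fin (m + 2)) :
    (pairBasis (m + 2)).coord x (pairParam t) = matParam t x.1 x.2 := by
  simp [pairBasis, pairParam]

theorem frameParam_ne_zero : frameParam t ≠ 0 := by
  intro h
  have h1 := coord_frameParam t (0, .inl 0)
  simp [h, zParam] at h1

theorem pairParam_ne_zero : pairParam t ≠ 0 := by
  intro h
  have h1 := coord_pairParam t (0, 0)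
  simp [h, matParam, colParam, rowParam, colParam₂] at h1

theorem mk_param_mem_varietyB :
    BiProj.mk (frameParam_ne_zero t) (pairParam_ne_zero t) ∈ varietyB (m + 2) (n + 1) := by
  rw [mk_mem_varietyB_iff]
  constructor
  · have h : (Matrix.of fun i j => (pairBasis (m + 2)).coord (i, j) (pairParam t)) =
        (Matrix.of fun i => ![colParam t i, colParam₂ t i]) *
          (Matrix.of ![rowParam t, rowParam₂ t]) := by
      ext i j
      simp only [Matrix.of_apply, coord_pairParam]
      simp [matParam, Matrix.mul_apply, Fin.sum_univ_two]
    rw [h]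
    exact (Matrix.rank_mul_le_left _ _).trans (Matrix.rank_le_width _)
  · intro k
    simp only [coord_frameParam, coord_pairParam, Sum.elim_inl, Sum.elim_inr, mul_assoc]
    simp only [← Finset.mul_sum]
    change ∑ i, wParam t k i * imageParam t k i = 0
    rw [Fin.sum_univ_succ]
    simp only [wParam, Fin.cons_zero, Fin.cons_succ, neg_mul, Finset.sum_mul]
    rw [neg_add_eq_zero]
    exact Finset.sum_congr rfl fun i _ => by ring

/-- The parametrized family of points of the variety. -/
def paramPoint : varietyB (m + 2) (n + 1) := ⟨_, mk_param_mem_varietyB t⟩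

theorem cons_mem_polyFun {ι : Type*} {k : ℕ} {a : (ι → ℂ) → ℂ} {f : (ι → ℂ) → Fin k → ℂ}
    (ha : a ∈ polyFun ι) (hf : ∀ i, (fun t => f t i) ∈ polyFun ι) (i : Fin (k + 1)) :
    (fun t => (Fin.cons (a t) (f t) : Fin (k + 1) → ℂ) i) ∈ polyFun ι := by
  refine Fin.cases ?_ (fun i => ?_) i
  · simpa using ha
  · simpa using hf i

theorem zParam_mem_polyFun (k : Fin (n + 1)) (i : Fin (m + 2)) :
    (fun t => zParam t k i) ∈ polyFun (Param m n) := by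
  unfold zParam
  by_cases h : (k, i) ≠ (0, 0)
  · simp only [dif_pos h]
    exact coord_mem_polyFun _
  · simp only [dif_neg h]
    exact const_mem_polyFun 1

theorem matParam_mem_polyFun (i j : Fin (m + 2)) :
    (fun t => matParam t i j) ∈ polyFun (Param m n) :=
  add_mem_polyFun
    (mul_mem_polyFun
      (cons_mem_polyFun (const_mem_polyFun 1) (fun _ => coord_mem_polyFun _) i)
      (cons_mem_polyFun (const_mem_polyFun 1) (fun _ => coord_mem_polyFun _) j))
    (mul_mem_polyFun
      (cons_mem_polyFun (const_mem_polyFun 0) (fun _ => coord_mem_polyFun _) i)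
      (cons_mem_polyFun (const_mem_polyFun 0) (fun i => cons_mem_polyFun (const_mem_polyFun 1)
        (fun _ => coord_mem_polyFun _) i) j))

theorem imageParam_mem_polyFun (k : Fin (n + 1)) (i : Fin (m + 2)) :
    (fun t => imageParam t k i) ∈ polyFun (Param m n) :=
  sum_mem_polyFun fun j => mul_mem_polyFun (matParam_mem_polyFun i j) (zParam_mem_polyFun k j)

theorem wParam_mem_polyFun (k : Fin (n + 1)) (i : Fin (m + 2)) :
    (fun t => wParam t k i) ∈ polyFun (Param m n) :=
  cons_mem_polyFun
    (neg_mem (sum_mem_polyFun fun i => mul_mem_polyFun (coord_mem_polyFun (Param.w (k, i)))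
      (imageParam_mem_polyFun k i.succ)))
    (fun i => mul_mem_polyFun (coord_mem_polyFun (Param.w (k, i)))
      (imageParam_mem_polyFun k 0)) i

open Classical in
theorem isIrreducible_range_paramPoint (s : Finset (Param m n)) :
    IsIrreducible (Set.range fun t : Param m n → ℂ =>
      paramPoint fun i => if i ∈ s then t i else 0) := by
  refine isIrreducible_of_image_val ?_
  rw [← Set.range_comp]
  have hψ : ∀ i, (fun t : Param m n → ℂ => if i ∈ s then t i else 0) ∈ polyFun (Param m n) := by
    intro i
    by_cases h : i ∈ s
    · simpa [h] using coord_mem_polyFun i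
    · simpa [h] using const_mem_polyFun 0
  refine isIrreducible_range_mk (fun t => frameParam_ne_zero _) (fun t => pairParam_ne_zero _)
    (fun l => comp_mem_polyFun (f := fun t => l (frameParam t)) ?_ hψ)
    (fun l => comp_mem_polyFun (f := fun t => l (pairParam t)) ?_ hψ)
  · refine dual_mem_polyFun (frameBasis _ _) (fun x => ?_) l
    simp only [coord_frameParam]
    obtain ⟨k, i | i⟩ := x
    exacts [zParam_mem_polyFun k i, wParam_mem_polyFun k i]
  · refine dual_mem_polyFun (pairBasis _) (fun x => ?_) l
    simp only [coord_pairParam]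
    exact matParam_mem_polyFun x.1 x.2

/-- The minor of `Q` on the rows `0, i` and the columns `0, j`. -/
def cornerMinor (i j : Fin (m + 2)) : CoordPoly (FramePair (m + 2) (n + 1)) (SymSkewPair (m + 2)) :=
  genericMatrix (m + 2) (n + 1) 0 0 * genericMatrix (m + 2) (n + 1) i j -
    genericMatrix (m + 2) (n + 1) i 0 * genericMatrix (m + 2) (n + 1) 0 j

/-- A bihomogeneous polynomial that detects whether the parameter vanishes. -/
def testPoly : Param m n → CoordPoly (FramePair (m + 2) (n + 1)) (SymSkewPair (m + 2))
  | .z x => X (.inl ((frameBasis (m + 2) (n + 1)).coord (x.1.1, .inl x.1.2)))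
  | .w x => X (.inl ((frameBasis (m + 2) (n + 1)).coord (x.1, .inr x.2.succ)))
  | .col i => genericMatrix (m + 2) (n + 1) i.succ 0
  | .row j => genericMatrix (m + 2) (n + 1) 0 j.succ
  | .col₂ i => cornerMinor i.succ 1
  | .row₂ j => cornerMinor 1 j.succ.succ

theorem isBihomogeneous_testPoly (p : Param m n) : IsBihomogeneous (testPoly p) := by
  have hX : ∀ l, IsBihomogeneous
      (X (.inl l) : CoordPoly (FramePair (m + 2) (n + 1)) (SymSkewPair (m + 2))) :=
    fun l => ⟨1, 0, MvPolynomial.isWeightedHomogeneous_X ℂ _ _⟩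
  have hG : ∀ i j, (genericMatrix (m + 2) (n + 1) i j).IsWeightedHomogeneous
      (bidegree _ _) (0, 1) := fun i j => MvPolynomial.isWeightedHomogeneous_X ℂ _ _
  have hM : ∀ i j, IsBihomogeneous (cornerMinor (m := m) (n := n) i j) := fun i j =>
    ⟨0, 2, ((hG 0 0).mul (hG i j)).sub ((hG i 0).mul (hG 0 j))⟩
  cases p with
  | z x => exact hX _
  | w x => exact hX _
  | col i => exact ⟨0, 1, hG _ _⟩
  | row j => exact ⟨0, 1, hG _ _⟩
  | col₂ i => exact hM _ _
  | row₂ j => exact hM _ _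

/-- The value of the test polynomial on the family: the parameter itself, times a factor that
involves parameters of other levels in the cases of `w` and `row₂`. -/
theorem evalAt_testPoly (p : Param m n) :
    evalAt (frameParam t) (pairParam t) (testPoly p) = t p *
      match p with
      | .w x => imageParam t x.1 0
      | .row₂ _ => t (.col₂ 0)
      | _ => 1 := by
  have hminor : ∀ i j : Fin (m + 2), evalAt (frameParam t) (pairParam t) (cornerMinor i j) =
      colParam₂ t i * rowParam₂ t j := by
    intro i j
    simp only [evalAt, cornerMinor, genericMatrix, Matrix.of_apply, map_sub, map_mul,
      MvPolynomial.eval_X, Sum.elim_inr, coord_pairParam, matParam]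
    simp only [colParam, rowParam, colParam₂, rowParam₂, Fin.cons_zero]
    ring
  cases p with
  | z x => simp [testPoly, evalAt, -Module.Basis.coord_apply, zParam, x.2]
  | w x => simp [testPoly, evalAt, -Module.Basis.coord_apply, wParam]
  | col i =>
    simp [testPoly, evalAt, genericMatrix, -Module.Basis.coord_apply, matParam, colParam, rowParam,
      colParam₂, rowParam₂]
  | row j =>
    simp [testPoly, evalAt, genericMatrix, -Module.Basis.coord_apply, matParam, colParam, rowParam,
      colParam₂, rowParam₂]
  | col₂ i =>
    have h1 : rowParam₂ t 1 = 1 := rfl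
    rw [testPoly, hminor, h1]
    simp [colParam₂]
  | row₂ j =>
    have h1 : colParam₂ t 1 = t (.col₂ 0) := rfl
    rw [testPoly, hminor, h1]
    simp [rowParam₂, mul_comm]

theorem card_param_le_topologicalKrullDim :
    (Fintype.card (Param m n) : WithBot ℕ∞) ≤
      topologicalKrullDim (varietyB (m + 2) (n + 1)) := by
  classical
  have hS : ∀ p : Param m n, ∀ f ∈ ({testPoly p} : Set _), IsBihomogeneous f := by
    rintro p _ rfl
    exact isBihomogeneous_testPoly p
  have hmem : ∀ (p : Param m n) t, paramPoint t ∈ Subtype.val ⁻¹' zeroLocus {testPoly p} ↔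
      evalAt (frameParam t) (pairParam t) (testPoly p) = 0 := by
    intro p t
    refine (mk_mem_zeroLocus (hS p) (frameParam_ne_zero t) (pairParam_ne_zero t)).trans ?_
    simp
  refine card_le_topologicalKrullDim (φ := paramPoint) isIrreducible_range_paramPoint Param.level
    (fun p => Subtype.val ⁻¹' zeroLocus {testPoly p})
    (fun p => (isClosed_iff.mpr ⟨_, hS p, rfl⟩).preimage continuous_subtype_val)
    (fun p t ht => ?_) fun p t ht hlow hhigh => ?_
  · rw [hmem, evalAt_testPoly, ht, zero_mul]
  · rw [hmem, evalAt_testPoly, ht, one_mul]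
    cases p with
    | z x => exact one_ne_zero
    | w x =>
      -- at this stage `Q` is the matrix unit at `(0, 0)`, so `(Q z)_0 = z_0 = 1`
      have hz : zParam t x.1 0 = 1 := by
        unfold zParam
        split_ifs with h
        exacts [hlow _ (by simp [Param.level]), rfl]
      have hrow : ∀ j : Fin (m + 1), t (.row j) = 0 := fun j => hhigh _ (by simp [Param.level])
      simp [imageParam, matParam, Fin.sum_univ_succ (n := m + 1), colParam, rowParam, colParam₂,
        hrow, hz]
    | col i => exact one_ne_zero
    | row j => exact one_ne_zero
    | col₂ i => exact one_ne_zero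
    | row₂ j =>
      change t (.col₂ 0) ≠ 0
      rw [hlow _ (by simp [Param.level])]
      exact one_ne_zero

end Parametrization

end PhaseRetrieval

end

theorem theorem3p3 (M N : ℕ) (hM : 2 ≤ M) (hN : 1 ≤ N) :
    IsClosed (PhaseRetrieval.varietyB M N) ∧
      ∃ d : ℕ, topologicalKrullDim (PhaseRetrieval.varietyB M N) = (d : WithBot ℕ∞) ∧
        (d : ℤ) = 2 * (M : ℤ) * N - N + 4 * M - 6 := by
  refine ⟨PhaseRetrieval.isClosed_varietyB, ?_⟩
  obtain ⟨m, rfl⟩ := Nat.exists_eq_add_of_le' hM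
  obtain ⟨n, rfl⟩ := Nat.exists_eq_add_of_le' hN
  have h1 := PhaseRetrieval.topologicalKrullDim_varietyB_le (N := n + 1) hM
  have h2 := PhaseRetrieval.card_param_le_topologicalKrullDim (m := m) (n := n)
  rw [PhaseRetrieval.Param.card] at h2
  have e1 : 2 * (m + 2) + 2 * (m + 2 - 2) + (n + 1) * (2 * (m + 2) - 1) - 2 =
      2 * m * n + 3 * n + 6 * m + 5 := by
    rw [Nat.add_sub_cancel, show 2 * (m + 2) - 1 = 2 * m + 3 by omega]
    refine Nat.sub_eq_of_eq_add ?_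
    ring
  have e2 : ((n + 1) * (m + 2) - 1 + (n + 1) * (m + 1)) + (3 * (m + 1) + m) =
      2 * m * n + 3 * n + 6 * m + 5 := by
    rw [show (n + 1) * (m + 2) - 1 = n * m + 2 * n + m + 1 from
      Nat.sub_eq_of_eq_add (by ring)]
    ring
  rw [e1] at h1
  rw [e2] at h2
  refine ⟨_, le_antisymm h1 h2, ?_⟩
  push_cast
  ring
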